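/- Let $n$ be a positive integer and let $\theta_1,\dots,\theta_n$ be real numbers with $0<\theta_i\le\pi$ for all $i$ and $\sum_{i=1}^n\theta_i<(n-1)\pi$. Then there is a convex equilateral $2n$-gon in the hyperbolic plane $\mathbf H^2$ whose interior angles, in cyclic order, are $\theta_1,\dots,\theta_n,\theta_1,\dots,\theta_n$. Here a $2n$-gon is an embedded closed polygon with $2n$ distinct vertices and geodesic sides (interior angles equal to $\pi$ are allowed at vertices), it is convex if it bounds a compact geodesically convex region, and it is equilateral if all its sides have the same length. -/

import Mathlib

open scoped UpperHalfPlane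

noncomputable section

namespace HypPolygon

/-- The geodesic segment `[a, b]` of the hyperbolic plane, as a metric segment: the points at
which the triangle inequality for `a` and `b` is an equality. -/
def geodSegment (a b : ℍ) : Set ℍ := {p | dist a p + dist p b = dist a b}

/-- Geodesic convexity of a set of the hyperbolic plane. -/
def GeodConvex (K : Set ℍ) : Prop := ∀ a ∈ K, ∀ b ∈ K, geodSegment a b ⊆ K

/-- A tangent vector at `z` (in the conformal upper half-plane chart) pointing along the geodesic
from `z` to `w`. The Cayley map `w ↦ (w - z) / (w - conj z)` is an isometry onto the Poincaré disc
sending `z` to `0` and the geodesics through `z` to diameters; its derivative at `z` is a positive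
multiple of `1 / I`, so the initial direction of the geodesic is `I * (w - z) / (w - conj z)`. -/
def direction (z w : ℍ) : ℂ :=
  Complex.I * (((w : ℂ) - (z : ℂ)) / ((w : ℂ) - (starRingEnd ℂ) (z : ℂ)))

/-- The angle in `[0, π]` at `b` between the geodesics from `b` to `a` and from `b` to `c`. The
upper half-plane model is conformal, so this is the Euclidean angle of the initial directions. -/
def hypAngle (a b c : ℍ) : ℝ :=
  InnerProductGeometry.angle (direction b a) (direction b c)

/-- The side from the `i`-th vertex to the cyclically next one. -/
def side {m : ℕ} (P : Fin m → ℍ) (i : Fin m) : Set ℍ :=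
  geodSegment (P i) (P (finRotate m i))

/-- The closed curve formed by the sides. -/
def boundary {m : ℕ} (P : Fin m → ℍ) : Set ℍ := ⋃ i, side P i

/-- The cyclic sequence `P` of vertices describes an embedded `m`-gon: consecutive sides
meet only in their common vertex, and other sides do not meet. Straight angles are allowed. -/
structure IsEmbedded {m : ℕ} (P : Fin m → ℍ) : Prop where
  three_le : 3 ≤ m
  injective : Function.Injective P
  adjacent : ∀ i, side P i ∩ side P (finRotate m i) = {P (finRotate m i)}
  nonadjacent : ∀ i j, i ≠ j → j ≠ finRotate m i → i ≠ finRotate m j →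
    Disjoint (side P i) (side P j)

/-- A convex `m`-gon: an embedded polygon bounding a compact convex region. -/
structure IsConvexPolygon {m : ℕ} (P : Fin m → ℍ) : Prop where
  embedded : IsEmbedded P
  bounds : ∃ K : Set ℍ, IsCompact K ∧ GeodConvex K ∧ frontier K = boundary P

/-- All sides have the same (positive) length. -/
def IsEquilateral {m : ℕ} (P : Fin m → ℍ) : Prop :=
  ∃ l : ℝ, 0 < l ∧ ∀ i, dist (P i) (P (finRotate m i)) = l

/-- The angle at the `i`-th vertex between the two sides that meet there. For a convex
polygon, whose interior angles are at most `π`, this is the interior angle. -/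
def vertexAngle {m : ℕ} (P : Fin m → ℍ) (i : Fin m) : ℝ :=
  hypAngle (P ((finRotate m).symm i)) (P i) (P (finRotate m i))

end HypPolygon

end

/-! Put φ_k = π - θ_k, extended with period n. These exterior angles lie in [0, π) and add up to
more than π over a period. Walk in the plane with steps of length log(1/q), 0 < q < 1, turning by
φ_k before step k. As Möbius maps, the frames are the products `word q φ k` of rotations and
dilations, and the vertices are the images of `I`. All sides are equal and all angles are right;
only q has to be chosen.

It suffices that the word N of length n has trace 0. Then N is a half-turn with N² scalar, the walk
closes after 2n steps, and the polygon is centrally symmetric. To reach this while keeping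
convexity, minimize over the trace and the upper left entries of all words of length at most n in
cyclic windows. This minimum is positive at q = 0. At q = 1 the upper left entries are cosines of
half the total turning, which exceeds π, so the minimum is negative. At a zero in between, a
vanishing entry would force a negative trace, so all entries are positive and the trace itself
vanishes (`exists_half_turn`).

Nonnegativity of these entries gives sign conditions on inner products of rows and columns
(`word_rows`, `colInner_word_nonneg`). By polynomial identities these say that every vertex lies to
the left of every side. In the hyperboloid model this is a linear condition, and with central
symmetry it yields an embedded polygon bounding a compact convex region
(`IsCentralChain.isConvexPolygon`). -/

noncomputable section

/-! ### The hyperboloid model: segments as cones, linear functionals. -/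

namespace HypPolygon

open Filter Topology

/-- The point of the upper sheet of the hyperboloid `u w - v² = 1` corresponding to `z`. -/
def vec (z : ℍ) : ℝ × ℝ × ℝ := ((z.re ^ 2 + z.im ^ 2) / z.im, z.re / z.im, 1 / z.im)

/-- The Lorentzian bilinear form polarizing `u w - v²`. -/
def lorentz (x y : ℝ × ℝ × ℝ) : ℝ := (x.1 * y.2.2 + x.2.2 * y.1) / 2 - x.2.1 * y.2.1

/-- The determinant of three vectors, with the sign for which counterclockwise triangles of the
hyperbolic plane have positive determinant. -/
def det3 (x y z : ℝ × ℝ × ℝ) : ℝ :=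
  x.1 * (y.2.2 * z.2.1 - y.2.1 * z.2.2) + x.2.1 * (y.1 * z.2.2 - y.2.2 * z.1)
    + x.2.2 * (y.2.1 * z.1 - y.1 * z.2.1)

theorem lorentz_add_right (x y z : ℝ × ℝ × ℝ) :
    lorentz x (y + z) = lorentz x y + lorentz x z := by
  simp only [lorentz, Prod.fst_add, Prod.snd_add]; ring

theorem lorentz_smul_right (c : ℝ) (x y : ℝ × ℝ × ℝ) :
    lorentz x (c • y) = c * lorentz x y := by
  simp only [lorentz, Prod.smul_fst, Prod.smul_snd, smul_eq_mul]; ring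

theorem lorentz_comm (x y : ℝ × ℝ × ℝ) : lorentz x y = lorentz y x := by
  simp only [lorentz]; ring

theorem det3_add_right (x y z w : ℝ × ℝ × ℝ) :
    det3 x y (z + w) = det3 x y z + det3 x y w := by
  simp only [det3, Prod.fst_add, Prod.snd_add]; ring

theorem det3_smul_right (c : ℝ) (x y z : ℝ × ℝ × ℝ) : det3 x y (c • z) = c * det3 x y z := by
  simp only [det3, Prod.smul_fst, Prod.smul_snd, smul_eq_mul]; ring

theorem det3_rotate (x y z : ℝ × ℝ × ℝ) : det3 x y z = det3 z x y := by
  simp only [det3]; ring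

theorem det3_swap (x y z : ℝ × ℝ × ℝ) : det3 x z y = -det3 x y z := by
  simp only [det3]; ring

theorem det3_self_right (x y : ℝ × ℝ × ℝ) : det3 x y y = 0 := by
  simp only [det3]; ring

theorem det3_self_outer (x y : ℝ × ℝ × ℝ) : det3 x y x = 0 := by
  simp only [det3]; ring

theorem cosh_dist_eq_lorentz (z w : ℍ) : Real.cosh (dist z w) = lorentz (vec z) (vec w) := by
  have hz := z.im_pos.ne'
  have hw := w.im_pos.ne'
  rw [UpperHalfPlane.cosh_dist', lorentz, vec, vec]
  field_simp
  ring

theorem lorentz_vec_self (z : ℍ) : lorentz (vec z) (vec z) = 1 := by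
  rw [← cosh_dist_eq_lorentz, dist_self, Real.cosh_zero]

theorem one_le_lorentz_vec (z w : ℍ) : 1 ≤ lorentz (vec z) (vec w) := by
  rw [← cosh_dist_eq_lorentz]; exact Real.one_le_cosh _

theorem continuous_vec : Continuous vec := by
  unfold vec
  have h := UpperHalfPlane.continuous_im
  have h' := UpperHalfPlane.continuous_re
  refine Continuous.prodMk ?_ (Continuous.prodMk ?_ ?_)
  · exact ((h'.pow 2).add (h.pow 2)).div h fun z => z.im_pos.ne'
  · exact h'.div h fun z => z.im_pos.ne'
  · exact continuous_const.div h fun z => z.im_pos.ne'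

theorem vec_injective : Function.Injective vec := by
  intro z w h
  apply dist_eq_zero.1
  have : Real.cosh (dist z w) = 1 := by
    rw [cosh_dist_eq_lorentz, h, lorentz_vec_self]
  by_contra hne
  exact (Real.one_lt_cosh.2 hne).ne' this

/-- A lightlike vector orthogonal to a timelike vector vanishes. -/
theorem eq_zero_of_lorentz_eq_zero (z : ℍ) (x : ℝ × ℝ × ℝ) (h : lorentz (vec z) x = 0)
    (hx : lorentz x x = 0) : x = 0 := by
  obtain ⟨u, v, w⟩ := x
  have hy := z.im_pos
  simp only [lorentz, vec] at h hx
  have h1 : (z.re ^ 2 + z.im ^ 2) * w + u - 2 * z.re * v = 0 := by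
    field_simp at h
    linarith
  have h2 : u * w = v ^ 2 := by linarith
  have h3 : (v - z.re * w) ^ 2 + (z.im * w) ^ 2 = 0 := by
    have : u = 2 * z.re * v - (z.re ^ 2 + z.im ^ 2) * w := by linarith
    rw [this] at h2
    linarith
  have hw : z.im * w = 0 := by
    nlinarith [sq_nonneg (v - z.re * w), sq_nonneg (z.im * w)]
  have hw : w = 0 := by
    rcases mul_eq_zero.1 hw with h | h
    · exact absurd h hy.ne'
    · exact h
  subst hw
  have hv : v = 0 := by
    have : v ^ 2 = 0 := by linarith
    exact pow_eq_zero_iff (two_ne_zero) |>.1 this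
  subst hv
  have : u = 0 := by linarith
  subst this
  rfl

/-- With s and t the distances to the ends, sinh(s+t) p - sinh t a - sinh s b is lightlike and
orthogonal to p, hence zero. -/
theorem exists_vec_eq_of_mem_geodSegment {a b p : ℍ} (hp : p ∈ geodSegment a b) :
    ∃ α β : ℝ, 0 ≤ α ∧ 0 ≤ β ∧ vec p = α • vec a + β • vec b := by
  have hp' : dist a p + dist p b = dist a b := hp
  set s := dist a p with hs
  set t := dist p b with ht
  have hs0 : 0 ≤ s := dist_nonneg
  have ht0 : 0 ≤ t := dist_nonneg
  rcases hs0.eq_or_lt with h0 | hspos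
  · have : a = p := dist_eq_zero.1 (by rw [← hs, ← h0])
    exact ⟨1, 0, zero_le_one, le_rfl, by simp [this]⟩
  have hS : 0 < Real.sinh (s + t) := Real.sinh_pos_iff.2 (by linarith)
  have hap : lorentz (vec a) (vec p) = Real.cosh s := (cosh_dist_eq_lorentz a p).symm
  have hpb : lorentz (vec p) (vec b) = Real.cosh t := (cosh_dist_eq_lorentz p b).symm
  have hab : lorentz (vec a) (vec b) = Real.cosh (s + t) := by
    rw [hp']; exact (cosh_dist_eq_lorentz a b).symm
  have haa := lorentz_vec_self a
  have hbb := lorentz_vec_self b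
  have hpp := lorentz_vec_self p
  have hpa : lorentz (vec p) (vec a) = Real.cosh s := by rw [lorentz_comm, hap]
  have key := eq_zero_of_lorentz_eq_zero p
    (Real.sinh (s + t) • vec p + ((-Real.sinh t) • vec a + (-Real.sinh s) • vec b)) ?_ ?_
  · refine ⟨Real.sinh t / Real.sinh (s + t), Real.sinh s / Real.sinh (s + t),
      div_nonneg (Real.sinh_nonneg_iff.2 ht0) hS.le,
      div_nonneg (Real.sinh_nonneg_iff.2 hs0) hS.le, ?_⟩
    have h1 : Real.sinh (s + t) • vec p = Real.sinh t • vec a + Real.sinh s • vec b := by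
      rw [neg_smul, neg_smul] at key
      have := eq_neg_of_add_eq_zero_left key
      rw [this]; abel
    rw [div_eq_inv_mul, div_eq_inv_mul, mul_smul, mul_smul, ← smul_add, ← h1, smul_smul,
      inv_mul_cancel₀ hS.ne', one_smul]
  · rw [lorentz_add_right, lorentz_add_right, lorentz_smul_right, lorentz_smul_right,
      lorentz_smul_right, hpp, hpa, hpb, Real.sinh_add]
    ring
  · have expand : ∀ (c d e : ℝ) (x y z : ℝ × ℝ × ℝ),
        lorentz (c • x + (d • y + e • z)) (c • x + (d • y + e • z)) =
          c ^ 2 * lorentz x x + d ^ 2 * lorentz y y + e ^ 2 * lorentz z z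
            + 2 * c * d * lorentz y x + 2 * c * e * lorentz x z + 2 * d * e * lorentz y z := by
      intro c d e x y z
      simp only [lorentz, Prod.fst_add, Prod.snd_add, Prod.smul_fst, Prod.smul_snd, smul_eq_mul]
      ring
    rw [expand, hpp, haa, hbb, hap, hpb, hab, Real.cosh_add, Real.sinh_add]
    have e1 := Real.cosh_sq s
    have e2 := Real.cosh_sq t
    linear_combination (-Real.sinh t ^ 2) * e1 + (-Real.sinh s ^ 2) * e2

/-- The norm condition α² + β² + 2αβ cosh d = 1 turns the expressions for cosh s and cosh t into
sinh s = β sinh d and sinh t = α sinh d. The addition formula then gives cosh(s+t) = cosh d. -/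
theorem mem_geodSegment_of_vec_eq {a b p : ℍ} {α β : ℝ} (hα : 0 ≤ α) (hβ : 0 ≤ β)
    (h : vec p = α • vec a + β • vec b) : p ∈ geodSegment a b := by
  have haa := lorentz_vec_self a
  have hbb := lorentz_vec_self b
  have hpp := lorentz_vec_self p
  set s := dist a p with hs
  set t := dist p b with ht
  set d := dist a b with hd
  have hs0 : 0 ≤ s := dist_nonneg
  have ht0 : 0 ≤ t := dist_nonneg
  have hd0 : 0 ≤ d := dist_nonneg
  have hab : lorentz (vec a) (vec b) = Real.cosh d := (cosh_dist_eq_lorentz a b).symm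
  have hap : Real.cosh s = α + β * Real.cosh d := by
    rw [hs, cosh_dist_eq_lorentz, h, lorentz_add_right, lorentz_smul_right, lorentz_smul_right,
      haa, hab]; ring
  have hpb : Real.cosh t = α * Real.cosh d + β := by
    rw [ht, cosh_dist_eq_lorentz, lorentz_comm, h, lorentz_add_right, lorentz_smul_right,
      lorentz_smul_right, hbb, lorentz_comm, hab]; ring
  have hone : α * Real.cosh s + β * Real.cosh t = 1 := by
    have := lorentz_add_right (vec p) (α • vec a) (β • vec b)
    rw [← h, hpp, lorentz_smul_right, lorentz_smul_right, ← cosh_dist_eq_lorentz,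
      ← cosh_dist_eq_lorentz, dist_comm p a] at this
    exact this.symm
  have hd2 := Real.cosh_sq d
  have hone' : α ^ 2 + β ^ 2 + 2 * α * β * Real.cosh d = 1 := by
    rw [hap, hpb] at hone; linarith
  have hsd : 0 ≤ Real.sinh d := Real.sinh_nonneg_iff.2 hd0
  have hss : Real.sinh s = β * Real.sinh d := by
    have h1 := Real.cosh_sq s
    have : Real.sinh s ^ 2 = (β * Real.sinh d) ^ 2 := by
      rw [hap] at h1
      linear_combination -h1 + hone' + (β ^ 2) * hd2
    exact (pow_left_inj₀ (Real.sinh_nonneg_iff.2 hs0) (mul_nonneg hβ hsd) two_ne_zero).1 this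
  have hst : Real.sinh t = α * Real.sinh d := by
    have h1 := Real.cosh_sq t
    have : Real.sinh t ^ 2 = (α * Real.sinh d) ^ 2 := by
      rw [hpb] at h1
      linear_combination -h1 + hone' + (α ^ 2) * hd2
    exact (pow_left_inj₀ (Real.sinh_nonneg_iff.2 ht0) (mul_nonneg hα hsd) two_ne_zero).1 this
  have hfin : Real.cosh (s + t) = Real.cosh d := by
    rw [Real.cosh_add, hap, hpb, hss, hst]
    linear_combination (Real.cosh d) * hone' - α * β * hd2
  have := le_antisymm (Real.cosh_le_cosh.1 hfin.le) (Real.cosh_le_cosh.1 hfin.ge)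
  change s + t = d
  rwa [abs_of_nonneg (add_nonneg hs0 ht0), abs_of_nonneg hd0] at this

/-- A linear functional on the hyperboloid that attains a local minimum `0` is zero. -/
theorem eq_zero_of_eventually_nonneg {p : ℍ} {A B C : ℝ}
    (h : ∀ᶠ z in 𝓝 p, 0 ≤ A * (vec z).1 + B * (vec z).2.1 + C * (vec z).2.2)
    (h0 : A * (vec p).1 + B * (vec p).2.1 + C * (vec p).2.2 = 0) : A = 0 ∧ B = 0 ∧ C = 0 := by
  -- Multiplication by the positive imaginary part turns the functional into a real polynomial,
  -- whose horizontal and vertical derivatives must vanish at p.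
  have hmul : ∀ z : ℍ, (A * (vec z).1 + B * (vec z).2.1 + C * (vec z).2.2) * z.im =
      A * (z.re ^ 2 + z.im ^ 2) + B * z.re + C := by
    intro z
    have := z.im_pos.ne'
    simp only [vec]
    field_simp
  have h1 : ∀ᶠ z : ℂ in 𝓝 (p : ℂ), 0 ≤ A * (z.re ^ 2 + z.im ^ 2) + B * z.re + C := by
    rw [← UpperHalfPlane.isOpenEmbedding_coe.map_nhds_eq, eventually_map]
    filter_upwards [h] with z hz
    have := mul_nonneg hz z.im_pos.le
    rw [hmul] at this
    exact this
  have h2 : A * (p.re ^ 2 + p.im ^ 2) + B * p.re + C = 0 := by rw [← hmul, h0, zero_mul]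
  have crit : ∀ b c : ℝ, (∀ᶠ t : ℝ in 𝓝 0, 0 ≤ b * t + c * t ^ 2) → b = 0 := by
    intro b c hbc
    have hmin : IsLocalMin (fun t : ℝ => b * t + c * t ^ 2) 0 := by
      filter_upwards [hbc] with t ht
      simpa using ht
    have hder : HasDerivAt (fun t : ℝ => b * t + c * t ^ 2) (b * 1 + c * (2 * 0 ^ (2 - 1) * 1)) 0 := by
      exact ((hasDerivAt_id' (0 : ℝ)).const_mul b).fun_add
        (((hasDerivAt_id' (0 : ℝ)).fun_pow 2).const_mul c)
    simpa using hmin.hasDerivAt_eq_zero hder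
  have hx : 2 * A * p.re + B = 0 := by
    refine crit _ A ?_
    have hc : Tendsto (fun t : ℝ => (p : ℂ) + t) (𝓝 0) (𝓝 (p : ℂ)) := by
      have : Continuous fun t : ℝ => (p : ℂ) + t := by fun_prop
      simpa using this.tendsto 0
    filter_upwards [hc.eventually h1] with t ht
    simp only [Complex.add_re, Complex.ofReal_re, Complex.add_im, Complex.ofReal_im] at ht
    change 0 ≤ A * ((p.re + t) ^ 2 + (p.im + 0) ^ 2) + B * (p.re + t) + C at ht
    nlinarith
  have hy : 2 * A * p.im = 0 := by
    refine crit _ A ?_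
    have hc : Tendsto (fun t : ℝ => (p : ℂ) + t * Complex.I) (𝓝 0) (𝓝 (p : ℂ)) := by
      have : Continuous fun t : ℝ => (p : ℂ) + t * Complex.I := by fun_prop
      simpa using this.tendsto 0
    filter_upwards [hc.eventually h1] with t ht
    simp only [Complex.add_re, Complex.add_im, Complex.mul_re, Complex.mul_im, Complex.ofReal_re,
      Complex.ofReal_im, Complex.I_re, Complex.I_im] at ht
    change 0 ≤ A * ((p.re + (t * 0 - 0 * 1)) ^ 2 + (p.im + (t * 1 + 0 * 0)) ^ 2)
      + B * (p.re + (t * 0 - 0 * 1)) + C at ht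
    nlinarith
  have hA : A = 0 := by
    rcases mul_eq_zero.1 hy with h | h
    · linarith
    · exact absurd h p.im_pos.ne'
  subst hA
  have hB : B = 0 := by linarith
  subst hB
  exact ⟨rfl, rfl, by linarith⟩

end HypPolygon

end

/-! ### Centrally symmetric chains bound convex polygons. -/

noncomputable section

namespace HypPolygon

open Filter Topology

theorem eq_of_vec_eq_smul {a p : ℍ} {c : ℝ} (hc : 0 ≤ c) (h : vec p = c • vec a) : p = a := by
  have : p ∈ geodSegment a a := mem_geodSegment_of_vec_eq (le_refl 0) hc (by simpa using h)
  have h' : dist a p + dist p a = dist a a := this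
  rw [dist_self, dist_comm] at h'
  exact dist_eq_zero.1 (by linarith [dist_nonneg (x := p) (y := a)])

theorem left_mem_geodSegment (a b : ℍ) : a ∈ geodSegment a b := by simp [geodSegment]

/-- A `2n`-periodic sequence of points, symmetric with respect to a center which lies strictly to
the left of all sides, such that all points lie to the left of all sides and such that no
point lies on a side that starts at one of the `n` preceding points, except for its endpoints. -/
structure IsCentralChain (n : ℕ) (P : ℕ → ℍ) (o : ℝ × ℝ × ℝ) (μ : ℕ → ℝ) : Prop where
  two_le : 2 ≤ n
  periodic : ∀ k, P (k + 2 * n) = P k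
  mu_pos : ∀ k, 0 < μ k
  antipodal : ∀ k, vec (P k) + vec (P (k + n)) = μ k • o
  left : ∀ k j, 0 ≤ det3 (vec (P k)) (vec (P (k + 1))) (vec (P j))
  center_left : ∀ k, 0 < det3 (vec (P k)) (vec (P (k + 1))) o
  notMem : ∀ k m, 2 ≤ m → m ≤ n → P (k + m) ∉ geodSegment (P k) (P (k + 1))

theorem continuous_det3_vec (a b : ℝ × ℝ × ℝ) : Continuous fun z : ℍ => det3 a b (vec z) := by
  have : Continuous fun x : ℝ × ℝ × ℝ => det3 a b x := by
    unfold det3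
    fun_prop
  exact this.comp continuous_vec

/-- The region to the left of all sides. -/
def leftRegion (P : ℕ → ℍ) : Set ℍ := {p | ∀ k, 0 ≤ det3 (vec (P k)) (vec (P (k + 1))) (vec p)}

theorem isClosed_leftRegion (P : ℕ → ℍ) : IsClosed (leftRegion P) := by
  simp only [leftRegion, Set.ofPred_forall]
  refine isClosed_iInter fun k => isClosed_le continuous_const ?_
  exact continuous_det3_vec _ _

theorem geodConvex_leftRegion (P : ℕ → ℍ) : GeodConvex (leftRegion P) := by
  intro a ha b hb p hp k
  obtain ⟨α, β, hα, hβ, h⟩ := exists_vec_eq_of_mem_geodSegment hp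
  rw [h, det3_add_right, det3_smul_right, det3_smul_right]
  exact add_nonneg (mul_nonneg hα (ha k)) (mul_nonneg hβ (hb k))

namespace IsCentralChain

variable {n : ℕ} {P : ℕ → ℍ} {o : ℝ × ℝ × ℝ} {μ : ℕ → ℝ}

theorem mod_eq (h : IsCentralChain n P o μ) (k : ℕ) : P (k % (2 * n)) = P k :=
  Function.Periodic.map_mod_nat h.periodic k

theorem det3_center_antipodal (h : IsCentralChain n P o μ) (k : ℕ) (x : ℝ × ℝ × ℝ) :
    det3 o x (vec (P (k + n))) = -det3 o x (vec (P k)) := by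
  have h1 : det3 o x (vec (P k) + vec (P (k + n))) = 0 := by
    rw [h.antipodal, det3_smul_right, det3_self_outer, mul_zero]
  rw [det3_add_right] at h1
  linarith

theorem det3_center_succ (h : IsCentralChain n P o μ) (k : ℕ) :
    0 < det3 o (vec (P k)) (vec (P (k + 1))) := by
  have := h.center_left k
  rwa [det3_rotate] at this

/-- Cramer's rule in the basis formed by two consecutive vertices and the center. -/
theorem exists_eq_of_sector (h : IsCentralChain n P o μ) {k : ℕ} {y : ℝ × ℝ × ℝ}
    (h1 : 0 ≤ det3 o (vec (P k)) y) (h2 : det3 o (vec (P (k + 1))) y ≤ 0) :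
    ∃ α β γ : ℝ, 0 ≤ α ∧ 0 ≤ β ∧ y = α • vec (P k) + β • vec (P (k + 1)) + γ • o := by
  have hd := h.det3_center_succ k
  set d := det3 o (vec (P k)) (vec (P (k + 1))) with hdef
  refine ⟨-det3 o (vec (P (k + 1))) y / d, det3 o (vec (P k)) y / d,
    det3 y (vec (P k)) (vec (P (k + 1))) / d, div_nonneg (by linarith) hd.le,
    div_nonneg h1 hd.le, ?_⟩
  have hd' : det3 o (vec (P k)) (vec (P (k + 1))) ≠ 0 := hd.ne'
  rw [hdef]
  generalize vec (P k) = a at *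
  generalize vec (P (k + 1)) = b at *
  refine Prod.ext ?_ (Prod.ext ?_ ?_) <;>
  · simp only [Prod.fst_add, Prod.snd_add, Prod.smul_fst, Prod.smul_snd, smul_eq_mul]
    field_simp
    simp only [det3]
    ring

/-- The sign of `det3 o (vec (P k)) y` flips when k increases by n, so it cannot stay positive:
somewhere it passes from ≥ 0 to ≤ 0, and there y is in the sector of a side. -/
theorem exists_sector (h : IsCentralChain n P o μ) (y : ℝ × ℝ × ℝ) :
    ∃ (k : ℕ) (α β γ : ℝ), 0 ≤ α ∧ 0 ≤ β ∧ y = α • vec (P k) + β • vec (P (k + 1)) + γ • o := by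
  suffices ∃ k, 0 ≤ det3 o (vec (P k)) y ∧ det3 o (vec (P (k + 1))) y ≤ 0 by
    obtain ⟨k, h1, h2⟩ := this
    exact ⟨k, h.exists_eq_of_sector h1 h2⟩
  by_contra! hcon
  have hanti : ∀ k, det3 o (vec (P (k + n))) y = -det3 o (vec (P k)) y := by
    intro k
    rw [det3_swap, h.det3_center_antipodal, det3_swap o (vec (P k)) y, neg_neg]
  obtain ⟨k, hk⟩ : ∃ k, 0 ≤ det3 o (vec (P k)) y := by
    rcases le_total 0 (det3 o (vec (P 0)) y) with h0 | h0
    · exact ⟨0, h0⟩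
    · exact ⟨0 + n, by rw [hanti]; linarith⟩
  have hall : ∀ m, 0 < det3 o (vec (P (k + 1 + m))) y := by
    intro m
    induction m with
    | zero => exact hcon k hk
    | succ m ih => exact hcon (k + 1 + m) ih.le
  have h1 := hall 0
  have h2 := hall n
  rw [hanti] at h2
  rw [add_zero] at h1
  linarith

/-- Fewer than n steps turn by less than a half-turn about the center. At a first failure the
antipode of `P j` would lie in the sector of the side from `P (j + m)`, with coefficient γ of the
center. That side gives γ ≥ 0, the side starting at the antipode gives γ ≤ 0. So the antipode lies
on the side, which `notMem` excludes. -/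
theorem det3_center_pos (h : IsCentralChain n P o μ) (j m : ℕ) (hm : 1 ≤ m) (hmn : m < n) :
    0 < det3 o (vec (P j)) (vec (P (j + m))) := by
  induction m, hm using Nat.le_induction with
  | base => exact h.det3_center_succ j
  | succ m hm ih =>
    have ih := ih (by omega)
    by_contra! hcon
    have e1 : 0 ≤ det3 o (vec (P (j + m))) (vec (P (j + n))) := by
      rw [h.det3_center_antipodal, det3_swap, neg_neg]; exact ih.le
    have e2 : det3 o (vec (P (j + m + 1))) (vec (P (j + n))) ≤ 0 := by
      rw [h.det3_center_antipodal, det3_swap, neg_neg]; exact hcon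
    obtain ⟨α, β, γ, hα, hβ, heq⟩ := h.exists_eq_of_sector e1 e2
    have f1 : 0 ≤ γ := by
      have := h.left (j + m) (j + n)
      rw [heq, det3_add_right, det3_add_right, det3_smul_right, det3_smul_right, det3_smul_right,
        det3_self_outer, det3_self_right] at this
      by_contra! hneg
      nlinarith [h.center_left (j + m)]
    have f2 : γ ≤ 0 := by
      have := det3_self_outer (vec (P (j + n))) (vec (P (j + n + 1)))
      nth_rewrite 2 [heq] at this
      rw [det3_add_right, det3_add_right, det3_smul_right, det3_smul_right, det3_smul_right]
        at this
      have g1 := mul_nonneg hα (h.left (j + n) (j + m))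
      have g2 := mul_nonneg hβ (h.left (j + n) (j + m + 1))
      by_contra! hneg
      have g3 := mul_pos hneg (h.center_left (j + n))
      linarith
    have f3 : γ = 0 := le_antisymm f2 f1
    rw [f3, zero_smul, add_zero] at heq
    refine h.notMem (j + m) (n - m) (by omega) (by omega) ?_
    have : j + m + (n - m) = j + n := by omega
    rw [this]
    exact mem_geodSegment_of_vec_eq hα hβ heq

theorem vec_combination_ne_zero (a b p : ℍ) (α β : ℝ) (hp : vec p = α • vec a + β • vec b) :
    ¬(α = 0 ∧ β = 0) := by
  rintro ⟨rfl, rfl⟩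
  have := lorentz_vec_self p
  rw [hp] at this
  simp [lorentz] at this

/-- Distinct sides with distance at most `n` meet only if they are adjacent. -/
theorem eq_of_mem_of_mem (h : IsCentralChain n P o μ) {i m : ℕ} (hm : 1 ≤ m) (hmn : m ≤ n) {p : ℍ}
    (h1 : p ∈ geodSegment (P i) (P (i + 1))) (h2 : p ∈ geodSegment (P (i + m)) (P (i + m + 1))) :
    m = 1 ∧ p = P (i + 1) := by
  have hn := h.two_le
  obtain ⟨α, β, hα, hβ, hp⟩ := exists_vec_eq_of_mem_geodSegment h1
  obtain ⟨γ, δ, hγ, hδ, hp'⟩ := exists_vec_eq_of_mem_geodSegment h2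
  have hne := vec_combination_ne_zero _ _ _ _ _ hp
  have hne' := vec_combination_ne_zero _ _ _ _ _ hp'
  have hs := h.det3_center_succ i
  have expand : ∀ (a b c d e : ℝ × ℝ × ℝ), det3 e (α • a + β • b) (γ • c + δ • d) =
      (α * γ) * det3 e a c + (α * δ) * det3 e a d + (β * γ) * det3 e b c
        + (β * δ) * det3 e b d := by
    intro a b c d e
    simp only [det3, Prod.fst_add, Prod.snd_add, Prod.smul_fst, Prod.smul_snd, smul_eq_mul]
    ring
  -- Expanding det(o, p, p) = 0 with the two expressions for p gives, for m < n, a sum of four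
  -- nonnegative terms, each of which must vanish.
  have hpp := det3_self_right o (vec p)
  nth_rewrite 1 [hp] at hpp
  rw [hp', expand] at hpp
  have hαγ := mul_nonneg hα hγ
  have hαδ := mul_nonneg hα hδ
  have hβγ := mul_nonneg hβ hγ
  have hβδ := mul_nonneg hβ hδ
  -- Opposite sides: modulo the center, the second is the negative of the first, so all coefficients
  -- would be zero.
  rcases hmn.eq_or_lt with rfl | hlt
  · exfalso
    have e1 := congrArg (det3 o (vec (P (i + 1)))) (hp.symm.trans hp')
    have e2 := congrArg (det3 o (vec (P i))) (hp.symm.trans hp')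
    have r : i + m + 1 = i + 1 + m := by ring
    simp only [det3_add_right, det3_smul_right, r, h.det3_center_antipodal, det3_self_right] at e1 e2
    rw [det3_swap o (vec (P i)) (vec (P (i + 1)))] at e1
    have a1 : (α + γ) * det3 o (vec (P i)) (vec (P (i + 1))) = 0 := by linarith
    have a2 : (β + δ) * det3 o (vec (P i)) (vec (P (i + 1))) = 0 := by linarith
    have a1 := (mul_eq_zero.1 a1).resolve_right hs.ne'
    have a2 := (mul_eq_zero.1 a2).resolve_right hs.ne'
    exact hne ⟨by linarith, by linarith⟩
  · have p1 := h.det3_center_pos i m hm hlt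
    have p2 := h.det3_center_pos (i + 1) m hm hlt
    have r : i + 1 + m = i + m + 1 := by ring
    rw [r] at p2
    have p3 : 0 ≤ det3 o (vec (P (i + 1))) (vec (P (i + m))) ∧
        (m ≠ 1 → 0 < det3 o (vec (P (i + 1))) (vec (P (i + m)))) := by
      by_cases hm1 : m = 1
      · subst hm1
        exact ⟨(det3_self_right _ _).ge, fun h => absurd rfl h⟩
      · have := h.det3_center_pos (i + 1) (m - 1) (by omega) (by omega)
        rw [show i + 1 + (m - 1) = i + m by omega] at this
        exact ⟨this.le, fun _ => this⟩
    have p4 : 0 ≤ det3 o (vec (P i)) (vec (P (i + m + 1))) ∧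
        (m + 1 ≠ n → 0 < det3 o (vec (P i)) (vec (P (i + m + 1)))) := by
      by_cases hm1 : m + 1 = n
      · have := h.det3_center_antipodal i (vec (P i))
        rw [det3_self_right, neg_zero, ← hm1, ← add_assoc] at this
        exact ⟨this.ge, fun h => absurd hm1 h⟩
      · have := h.det3_center_pos i (m + 1) (by omega) (by omega)
        rw [← add_assoc] at this
        exact ⟨this.le, fun _ => this⟩
    have z1 := mul_nonneg hαγ p1.le
    have z2 := mul_nonneg hαδ p4.1
    have z3 := mul_nonneg hβγ p3.1
    have z4 := mul_nonneg hβδ p2.le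
    have y1 : α * γ = 0 := (mul_eq_zero.1 (by linarith : _ * _ = (0 : ℝ))).resolve_right p1.ne'
    have y4 : β * δ = 0 := (mul_eq_zero.1 (by linarith : _ * _ = (0 : ℝ))).resolve_right p2.ne'
    by_cases hα0 : α = 0
    · have hβ0 : β ≠ 0 := fun hβ0 => hne ⟨hα0, hβ0⟩
      have hδ0 : δ = 0 := (mul_eq_zero.1 y4).resolve_left hβ0
      have hγ0 : γ ≠ 0 := fun hγ0 => hne' ⟨hγ0, hδ0⟩
      refine ⟨?_, ?_⟩
      · by_contra hm1
        have := mul_pos ((mul_nonneg hβ hγ).lt_of_ne' (mul_ne_zero hβ0 hγ0)) (p3.2 hm1)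
        linarith
      · rw [hα0, zero_smul, zero_add] at hp
        exact eq_of_vec_eq_smul hβ hp
    · exfalso
      have hγ0 : γ = 0 := (mul_eq_zero.1 y1).resolve_left hα0
      have hδ0 : δ ≠ 0 := fun hδ0 => hne' ⟨hγ0, hδ0⟩
      have hβ0 : β = 0 := (mul_eq_zero.1 y4).resolve_right hδ0
      -- Here p would be both `P i` and `P (i + m + 1)`; these are antipodal when m + 1 = n, and
      -- otherwise have positive determinant with the center.
      by_cases hm1 : m + 1 = n
      · rw [hβ0, zero_smul, add_zero] at hp
        rw [hγ0, zero_smul, zero_add] at hp'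
        have e1 := congrArg (det3 o (vec (P (i + 1)))) (hp.symm.trans hp')
        rw [add_assoc, hm1, det3_smul_right, det3_smul_right, h.det3_center_antipodal,
          det3_swap o (vec (P i))] at e1
        have e2 : (α + δ) * det3 o (vec (P i)) (vec (P (i + 1))) = 0 := by linarith
        have e3 := (mul_eq_zero.1 e2).resolve_right hs.ne'
        exact hα0 (by linarith)
      · have := mul_pos ((mul_nonneg hα hδ).lt_of_ne' (mul_ne_zero hα0 hδ0)) (p4.2 hm1)
        linarith

theorem ne_succ (h : IsCentralChain n P o μ) (i : ℕ) : P i ≠ P (i + 1) := by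
  intro he
  have := h.det3_center_succ i
  rw [← he, det3_self_right] at this
  exact lt_irrefl _ this

theorem finRotate_val {m : ℕ} (i : Fin m) : (finRotate m i : ℕ) = (i + 1) % m := by
  have := i.neZero
  rw [finRotate_apply, Fin.val_add, Fin.val_one', Nat.add_mod_mod]

theorem apply_finRotate (h : IsCentralChain n P o μ) (i : Fin (2 * n)) :
    P (finRotate (2 * n) i) = P (i + 1) := by
  rw [finRotate_val, h.mod_eq]

theorem side_eq (h : IsCentralChain n P o μ) (i : Fin (2 * n)) :
    side (fun j : Fin (2 * n) => P j) i = geodSegment (P i) (P (i + 1)) := by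
  simp only [side, h.apply_finRotate]

theorem isEmbedded (h : IsCentralChain n P o μ) : IsEmbedded fun i : Fin (2 * n) => P i := by
  have hn := h.two_le
  have wrap : ∀ k, geodSegment (P (k + 2 * n)) (P (k + 2 * n + 1)) =
      geodSegment (P k) (P (k + 1)) := by
    intro k
    rw [h.periodic, add_right_comm, h.periodic]
  have meet : ∀ i j : ℕ, i < j → j < 2 * n → ∀ p, p ∈ geodSegment (P i) (P (i + 1)) →
      p ∈ geodSegment (P j) (P (j + 1)) →
      (j = i + 1 ∧ p = P (i + 1)) ∨ (j + 1 = i + 2 * n ∧ p = P (j + 1)) := by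
    intro i j hij hj p hp hp'
    obtain ⟨m, rfl⟩ : ∃ m, j = i + m := ⟨j - i, by omega⟩
    by_cases hm : m ≤ n
    · obtain ⟨rfl, h2⟩ := h.eq_of_mem_of_mem (by omega) hm hp hp'
      exact Or.inl ⟨rfl, h2⟩
    · rw [← wrap i, show i + 2 * n = i + m + (2 * n - m) by omega] at hp
      obtain ⟨h1, h2⟩ := h.eq_of_mem_of_mem (by omega) (by omega) hp' hp
      exact Or.inr ⟨by omega, h2⟩
  have inj : ∀ i j : ℕ, i < j → j < 2 * n → P i ≠ P j := by
    intro i j hij hj he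
    rcases meet i j hij hj (P i) (left_mem_geodSegment _ _)
      (by rw [he]; exact left_mem_geodSegment _ _) with ⟨_, h2⟩ | ⟨_, h2⟩
    · exact h.ne_succ i h2
    · exact h.ne_succ j (he ▸ h2)
  refine ⟨by omega, ?_, ?_, ?_⟩
  · intro i j hij
    rcases lt_trichotomy (i : ℕ) j with hlt | heq | hlt
    · exact absurd hij (inj i j hlt j.2)
    · exact Fin.ext heq
    · exact absurd hij.symm (inj j i hlt i.2)
  · intro i
    have e : geodSegment (P (finRotate (2 * n) i)) (P ((finRotate (2 * n) i : ℕ) + 1)) =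
        geodSegment (P (i + 1)) (P (i + 1 + 1)) := by
      rw [h.apply_finRotate, finRotate_val, ← h.mod_eq ((i + 1) % (2 * n) + 1), Nat.mod_add_mod,
        h.mod_eq]
    rw [h.side_eq, h.side_eq, e, h.apply_finRotate]
    ext p
    constructor
    · rintro ⟨h1, h2⟩
      exact (h.eq_of_mem_of_mem le_rfl (by omega) h1 h2).2
    · rintro rfl
      exact ⟨by simp [geodSegment], left_mem_geodSegment _ _⟩
  · intro i j hij hji hij'
    rw [h.side_eq, h.side_eq]
    have fin_ne : ∀ a b : Fin (2 * n), (a : ℕ) < b →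
        b ≠ finRotate (2 * n) a → a ≠ finRotate (2 * n) b →
        Disjoint (geodSegment (P a) (P (a + 1))) (geodSegment (P b) (P (b + 1))) := by
      intro a b hab hb ha
      refine Set.disjoint_left.2 fun p hp hp' => ?_
      rcases meet a b hab b.2 p hp hp' with ⟨h1, _⟩ | ⟨h1, _⟩
      · apply hb
        apply Fin.ext
        rw [finRotate_val, ← h1, Nat.mod_eq_of_lt b.2]
      · apply ha
        apply Fin.ext
        rw [finRotate_val, h1, Nat.add_mod_right, Nat.mod_eq_of_lt a.2]
    rcases lt_trichotomy (i : ℕ) j with hlt | heq | hlt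
    · exact fin_ne i j hlt hji hij'
    · exact absurd (Fin.ext heq) hij
    · exact (fin_ne j i hlt hij' hji).symm

/-- The functional of side k kills its two endpoints and is positive at the center. -/
theorem center_coeff_nonneg (h : IsCentralChain n P o μ) {p : ℍ} (hp : p ∈ leftRegion P) {k : ℕ}
    {α β γ : ℝ} (heq : vec p = α • vec (P k) + β • vec (P (k + 1)) + γ • o) : 0 ≤ γ := by
  have := hp k
  rw [heq, det3_add_right, det3_add_right, det3_smul_right, det3_smul_right, det3_smul_right,
    det3_self_outer, det3_self_right] at this
  by_contra! hneg
  nlinarith [h.center_left k]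

/-- A point p of the region is a nonnegative combination Σ c_j P_j of vertices, since the center is
a positive multiple of P_0 + P_n. Pairing with p gives Σ c_j ⟨p, P_j⟩ = 1 with all ⟨p, P_j⟩ ≥ 1.
Hence ⟨P_0, p⟩ ≤ M, where M bounds all ⟨P_0, P_j⟩. -/
theorem isBounded_leftRegion (h : IsCentralChain n P o μ) :
    Bornology.IsBounded (leftRegion P) := by
  have hn := h.two_le
  set M : ℝ := ∑ j ∈ Finset.range (2 * n), lorentz (vec (P 0)) (vec (P j)) with hM
  have hMj : ∀ j, lorentz (vec (P 0)) (vec (P j)) ≤ M := by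
    intro j
    rw [← h.mod_eq j]
    exact Finset.single_le_sum (f := fun j => lorentz (vec (P 0)) (vec (P j)))
      (fun i _ => zero_le_one.trans (one_le_lorentz_vec _ _))
      (Finset.mem_range.2 (Nat.mod_lt _ (by omega)))
  have hM0 : 0 ≤ M := zero_le_one.trans ((one_le_lorentz_vec _ _).trans (hMj 0))
  refine (Metric.isBounded_closedBall (x := P 0) (r := M)).subset fun p hp => ?_
  obtain ⟨k, α, β, γ, hα, hβ, heq⟩ := h.exists_sector (vec p)
  have hγ := h.center_coeff_nonneg hp heq
  have ho : o = (μ 0)⁻¹ • (vec (P 0) + vec (P (0 + n))) := by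
    rw [h.antipodal, smul_smul, inv_mul_cancel₀ (h.mu_pos 0).ne', one_smul]
  set δ := γ * (μ 0)⁻¹ with hδ
  have hδ0 : 0 ≤ δ := mul_nonneg hγ (inv_nonneg.2 (h.mu_pos 0).le)
  rw [ho, smul_smul, ← hδ] at heq
  have expand : ∀ x, lorentz x (vec p) = α * lorentz x (vec (P k)) +
      β * lorentz x (vec (P (k + 1))) + δ * lorentz x (vec (P 0)) +
        δ * lorentz x (vec (P (0 + n))) := by
    intro x
    rw [heq]
    simp only [lorentz_add_right, lorentz_smul_right]
    ring
  have e1 := expand (vec p)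
  rw [lorentz_vec_self] at e1
  have e2 := expand (vec (P 0))
  have bound : ∀ c : ℝ, 0 ≤ c → ∀ j, c * lorentz (vec (P 0)) (vec (P j)) ≤
      M * (c * lorentz (vec p) (vec (P j))) := by
    intro c hc j
    have h1 := mul_le_mul_of_nonneg_left (hMj j) hc
    have h2 := mul_le_mul_of_nonneg_left (one_le_lorentz_vec p (P j)) (mul_nonneg hM0 hc)
    linarith
  have b1 := bound α hα k
  have b2 := bound β hβ (k + 1)
  have b3 := bound δ hδ0 0
  have b4 := bound δ hδ0 (0 + n)
  have hle : lorentz (vec (P 0)) (vec p) ≤ M := by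
    calc lorentz (vec (P 0)) (vec p) ≤ M * 1 := by rw [e1, e2]; linarith
      _ = M := mul_one M
  rw [← cosh_dist_eq_lorentz, dist_comm] at hle
  rw [Metric.mem_closedBall]
  have := Real.self_le_sinh_iff.2 (dist_nonneg (x := p) (y := P 0))
  linarith [Real.sinh_lt_cosh (dist p (P 0))]

/-- In the sector of a side, the coefficient γ of the center decides: γ = 0 puts the point on the
side, γ > 0 makes all side functionals positive nearby. Conversely, a side functional vanishes on
its side, and could not stay nonnegative around such a point without being zero. -/
theorem frontier_leftRegion (h : IsCentralChain n P o μ) :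
    frontier (leftRegion P) = boundary fun i : Fin (2 * n) => P i := by
  have hn := h.two_le
  rw [(isClosed_leftRegion P).frontier_eq]
  ext p
  simp only [boundary, Set.mem_iUnion, h.side_eq, Set.mem_sdiff]
  constructor
  · rintro ⟨hp, hint⟩
    obtain ⟨k, α, β, γ, hα, hβ, heq⟩ := h.exists_sector (vec p)
    have hγ := h.center_coeff_nonneg hp heq
    rcases hγ.eq_or_lt with h0 | hpos
    · rw [← h0, zero_smul, add_zero] at heq
      refine ⟨⟨k % (2 * n), Nat.mod_lt _ (by omega)⟩, ?_⟩
      have := mem_geodSegment_of_vec_eq hα hβ heq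
      simp only
      rwa [h.mod_eq, ← h.mod_eq (k % (2 * n) + 1), Nat.mod_add_mod, h.mod_eq]
    · exfalso
      apply hint
      have hopen : IsOpen (⋂ j ∈ Finset.range (2 * n),
          {z : ℍ | 0 < det3 (vec (P j)) (vec (P (j + 1))) (vec z)}) := by
        exact isOpen_biInter_finset fun j _ =>
          isOpen_lt continuous_const (continuous_det3_vec _ _)
      refine mem_interior.2 ⟨_, ?_, hopen, ?_⟩
      · intro z hz k
        simp only [Set.mem_iInter] at hz
        have := hz (k % (2 * n)) (Finset.mem_range.2 (Nat.mod_lt _ (by omega)))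
        simp only [Set.mem_ofPred_eq] at this
        rw [h.mod_eq, ← h.mod_eq (k % (2 * n) + 1), Nat.mod_add_mod, h.mod_eq] at this
        exact this.le
      · simp only [Set.mem_iInter]
        intro j _
        simp only [Set.mem_ofPred_eq]
        rw [heq, det3_add_right, det3_add_right, det3_smul_right, det3_smul_right,
          det3_smul_right]
        have g1 := mul_nonneg hα (h.left j k)
        have g2 := mul_nonneg hβ (h.left j (k + 1))
        have g3 := mul_pos hpos (h.center_left j)
        linarith
  · rintro ⟨i, hi⟩
    obtain ⟨α, β, hα, hβ, heq⟩ := exists_vec_eq_of_mem_geodSegment hi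
    refine ⟨?_, ?_⟩
    · intro k
      rw [heq, det3_add_right, det3_smul_right, det3_smul_right]
      exact add_nonneg (mul_nonneg hα (h.left _ _)) (mul_nonneg hβ (h.left _ _))
    · intro hint
      have hev : ∀ᶠ z in 𝓝 p, 0 ≤ det3 (vec (P i)) (vec (P (i + 1))) (vec z) := by
        filter_upwards [mem_interior_iff_mem_nhds.1 hint] with z hz using hz i
      have h0 : det3 (vec (P i)) (vec (P (i + 1))) (vec p) = 0 := by
        rw [heq, det3_add_right, det3_smul_right, det3_smul_right, det3_self_outer,
          det3_self_right]
        ring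
      have hpos := h.center_left i
      generalize vec (P i) = a at *
      generalize vec (P (i + 1)) = b at *
      have form : ∀ x : ℝ × ℝ × ℝ, det3 a b x = (a.2.2 * b.2.1 - a.2.1 * b.2.2) * x.1 +
          (a.1 * b.2.2 - a.2.2 * b.1) * x.2.1 + (a.2.1 * b.1 - a.1 * b.2.1) * x.2.2 := by
        intro x
        simp only [det3]
        ring
      simp only [form] at hev h0 hpos
      obtain ⟨z1, z2, z3⟩ := eq_zero_of_eventually_nonneg hev h0
      rw [z1, z2, z3] at hpos
      simp at hpos

theorem isConvexPolygon (h : IsCentralChain n P o μ) :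
    IsConvexPolygon fun i : Fin (2 * n) => P i :=
  ⟨h.isEmbedded, leftRegion P,
    Metric.isCompact_of_isClosed_isBounded (isClosed_leftRegion P) h.isBounded_leftRegion,
    geodConvex_leftRegion P, h.frontier_leftRegion⟩

end IsCentralChain

end HypPolygon

end

/-! ### Words of rotations and dilations; choice of the side length. -/

noncomputable section

namespace HypPolygon

/-- The matrix acting on the upper half-plane as the rotation about `I` by the angle `t`. -/
def rotM (t : ℝ) : Matrix (Fin 2) (Fin 2) ℝ :=
  !![Real.cos (t / 2), Real.sin (t / 2); -Real.sin (t / 2), Real.cos (t / 2)]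

/-- The matrix acting on the upper half-plane as `z ↦ z / q`. -/
def dilM (q : ℝ) : Matrix (Fin 2) (Fin 2) ℝ := !![1, 0; 0, q]

/-- The product of the first `m` matrices `rotM (ψ j) * dilM q`. -/
def word (q : ℝ) (ψ : ℕ → ℝ) : ℕ → Matrix (Fin 2) (Fin 2) ℝ
  | 0 => 1
  | m + 1 => word q ψ m * (rotM (ψ m) * dilM q)

/-- The inner product of the two rows. -/
def rowInner (A : Matrix (Fin 2) (Fin 2) ℝ) : ℝ := A 0 0 * A 1 0 + A 0 1 * A 1 1

variable {q : ℝ} {ψ : ℕ → ℝ}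

theorem word_succ_apply (m : ℕ) (i : Fin 2) :
    word q ψ (m + 1) i 0 =
        word q ψ m i 0 * Real.cos (ψ m / 2) - word q ψ m i 1 * Real.sin (ψ m / 2) ∧
      word q ψ (m + 1) i 1 =
        q * (word q ψ m i 0 * Real.sin (ψ m / 2) + word q ψ m i 1 * Real.cos (ψ m / 2)) := by
  simp only [word, rotM, dilM, Matrix.mul_apply, Fin.sum_univ_two, Matrix.of_apply,
    Matrix.cons_val', Matrix.cons_val_zero, Matrix.cons_val_one, Matrix.cons_val_fin_one]
  constructor <;> ring

theorem det_word (q : ℝ) (ψ : ℕ → ℝ) (m : ℕ) : (word q ψ m).det = q ^ m := by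
  induction m with
  | zero => simp [word]
  | succ m ih =>
    have := Real.sin_sq_add_cos_sq (ψ m / 2)
    rw [word, Matrix.det_mul, Matrix.det_mul, ih, rotM, dilM, Matrix.det_fin_two_of,
      Matrix.det_fin_two_of, pow_succ]
    linear_combination (q ^ m * q) * this

theorem word_add (q : ℝ) (ψ : ℕ → ℝ) (a b : ℕ) :
    word q ψ (a + b) = word q ψ a * word q (fun t => ψ (a + t)) b := by
  induction b with
  | zero => simp [word]
  | succ b ih => rw [← add_assoc, word, ih, word, mul_assoc]

theorem word_congr {ψ' : ℕ → ℝ} (m : ℕ) (h : ∀ j < m, ψ j = ψ' j) : word q ψ m = word q ψ' m := by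
  induction m with
  | zero => rfl
  | succ m ih => rw [word, word, ih fun j hj => h j (by omega), h m (by omega)]

theorem word_of_eq_zero (m : ℕ) (h : ∀ j < m, ψ j = 0) : word q ψ m = !![1, 0; 0, q ^ m] := by
  induction m with
  | zero => simp [word, Matrix.one_fin_two]
  | succ m ih =>
    rw [word, ih fun j hj => h j (by omega), h m (by omega)]
    simp [rotM, dilM, pow_succ]

/-- If the upper left entries of all initial subwords are nonnegative, then the second row of
a word makes an obtuse angle with the first row, and both lie in fixed half-planes. -/
theorem word_rows (hq0 : 0 < q) (hq1 : q < 1) (hψ0 : ∀ j, 0 ≤ ψ j) (hψπ : ∀ j, ψ j < Real.pi)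
    (m : ℕ) (ha : ∀ j ≤ m, 0 ≤ word q ψ j 0 0) :
    0 ≤ word q ψ m 0 1 ∧ word q ψ m 1 0 ≤ 0 ∧ rowInner (word q ψ m) ≤ 0 ∧
      ((∃ j < m, 0 < ψ j) → rowInner (word q ψ m) < 0) := by
  induction m with
  | zero => simp [word, rowInner]
  | succ m ih =>
    obtain ⟨hb, hc, hip, hstrict⟩ := ih fun j hj => ha j (by omega)
    have ha0 := ha m (by omega)
    have ha1 := ha (m + 1) le_rfl
    have hdet := det_word q ψ m
    have hqm : 0 < q ^ m := by positivity
    rw [Matrix.det_fin_two] at hdet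
    have hC : 0 < Real.cos (ψ m / 2) :=
      Real.cos_pos_of_mem_Ioo ⟨by linarith [hψ0 m, Real.pi_pos], by linarith [hψπ m]⟩
    have hS : 0 ≤ Real.sin (ψ m / 2) :=
      Real.sin_nonneg_of_nonneg_of_le_pi (by linarith [hψ0 m])
        (by linarith [hψπ m, Real.pi_pos])
    have hCS := Real.sin_sq_add_cos_sq (ψ m / 2)
    have hSpos : 0 < ψ m → 0 < Real.sin (ψ m / 2) := fun h =>
      Real.sin_pos_of_pos_of_lt_pi (by linarith) (by linarith [hψπ m, Real.pi_pos])
    obtain ⟨r1, r2⟩ := word_succ_apply (q := q) (ψ := ψ) m 0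
    obtain ⟨r3, r4⟩ := word_succ_apply (q := q) (ψ := ψ) m 1
    -- Before the first nonzero angle the word is diagonal; this starts the strict inequality.
    have hzero : (∀ j < m, ψ j = 0) → word q ψ m 0 1 = 0 ∧ word q ψ m 1 0 = 0 ∧
        word q ψ m 0 0 = 1 ∧ 0 < word q ψ m 1 1 := by
      intro h
      rw [word_of_eq_zero m h]
      simpa using hqm
    simp only [rowInner] at hip hstrict ⊢
    rw [r1] at ha1
    rw [r1, r2, r3, r4]
    generalize word q ψ m 0 0 = a at *
    generalize word q ψ m 0 1 = b at *
    generalize word q ψ m 1 0 = c at *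
    generalize word q ψ m 1 1 = d at *
    set C := Real.cos (ψ m / 2)
    set S := Real.sin (ψ m / 2)
    set a' := a * C - b * S with ha'
    set b' := a * S + b * C with hb'
    set c' := c * C - d * S with hc'
    set d' := c * S + d * C with hd'
    have hdet' : a' * d' - b' * c' = q ^ m := by
      rw [ha', hb', hc', hd', ← hdet]
      linear_combination (a * d - b * c) * hCS
    have hip_eq : a' * c' + b' * d' = a * c + b * d := by
      rw [ha', hb', hc', hd']
      linear_combination (a * c + b * d) * hCS
    have hb'0 : 0 ≤ b' := add_nonneg (mul_nonneg ha0 hS) (mul_nonneg hb hC.le)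
    -- If c' > 0, the positive determinant forces a', d' > 0, and the row inner product, unchanged
    -- by the rotation, would be positive.
    have hc'0 : c' ≤ 0 := by
      by_contra! hpos
      have hbc : 0 ≤ b' * c' := mul_nonneg hb'0 hpos.le
      have had : 0 < a' * d' := by linarith
      have ha'pos : 0 < a' := ha1.lt_of_ne' fun h => by rw [h, zero_mul] at had; exact lt_irrefl _ had
      have hd'pos : 0 < d' := (mul_pos_iff_of_pos_left ha'pos).1 had
      have := mul_pos ha'pos hpos
      have := mul_nonneg hb'0 hd'pos.le
      linarith
    have hac : a' * c' ≤ 0 := mul_nonpos_of_nonneg_of_nonpos ha1 hc'0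
    have hq2 : q ^ 2 < 1 := pow_lt_one₀ hq0.le hq1 two_ne_zero
    have hq2' : 0 < q ^ 2 := by positivity
    -- The dilation only multiplies b'd' by q² < 1. As a'c' ≤ 0, the sum stays nonpositive whatever
    -- the sign of b'd'.
    have hform : a' * c' + q * b' * (q * d') = a' * c' + q ^ 2 * (b' * d') := by ring
    refine ⟨mul_nonneg hq0.le hb'0, hc'0, ?_, ?_⟩
    · rw [hform]
      rcases le_total (b' * d') 0 with h | h
      · linarith [mul_nonpos_of_nonneg_of_nonpos hq2'.le h]
      · linarith [mul_nonneg (sub_nonneg.2 hq2.le) h]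
    · rintro ⟨j, hj, hjpos⟩
      rw [hform]
      by_cases hex : ∃ j < m, 0 < ψ j
      · have hlt := hstrict hex
        rw [← hip_eq] at hlt
        rcases lt_trichotomy (b' * d') 0 with h | h | h
        · linarith [mul_neg_of_pos_of_neg hq2' h]
        · rw [h] at hlt ⊢; linarith
        · linarith [mul_pos (sub_pos.2 hq2) h]
      · push Not at hex
        obtain ⟨z1, z2, z3, z4⟩ := hzero fun j hj => le_antisymm (hex j hj) (hψ0 j)
        have hjm : j = m := by
          by_contra hne
          exact absurd hjpos (not_lt.2 (hex j (by omega)))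
        have hSp := hSpos (hjm ▸ hjpos)
        rw [ha', hb', hc', hd', z1, z2, z3]
        have h1 : 0 < d * S * C := mul_pos (mul_pos z4 hSp) hC
        have h2 : (1 * C - 0 * S) * (0 * C - d * S) + q ^ 2 * ((1 * S + 0 * C) * (0 * S + d * C))
          = -((1 - q ^ 2) * (d * S * C)) := by ring
        rw [h2]
        exact neg_neg_of_pos (mul_pos (by linarith) h1)

theorem continuous_word (ψ : ℕ → ℝ) (m : ℕ) : Continuous fun q => word q ψ m := by
  have hd : Continuous dilM := by
    refine continuous_matrix fun i j => ?_
    fin_cases i <;> fin_cases j <;> simp [dilM] <;> fun_prop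
  induction m with
  | zero => exact continuous_const
  | succ m ih => exact ih.matrix_mul (continuous_const.matrix_mul hd)

theorem word_one_apply (ψ : ℕ → ℝ) (m : ℕ) :
    word 1 ψ m 0 0 = Real.cos ((∑ j ∈ Finset.range m, ψ j) / 2) ∧
      word 1 ψ m 0 1 = Real.sin ((∑ j ∈ Finset.range m, ψ j) / 2) := by
  induction m with
  | zero => simp [word]
  | succ m ih =>
    obtain ⟨r1, r2⟩ := word_succ_apply (q := 1) (ψ := ψ) m 0
    rw [r1, r2, ih.1, ih.2, Finset.sum_range_succ, add_div, Real.cos_add, Real.sin_add]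
    constructor <;> ring

theorem word_zero_apply (hψ0 : ∀ j, 0 ≤ ψ j) (hψπ : ∀ j, ψ j < Real.pi) (m : ℕ) :
    0 < word 0 ψ m 0 0 ∧ word 0 ψ m 0 1 = 0 := by
  induction m with
  | zero => simp [word]
  | succ m ih =>
    obtain ⟨r1, r2⟩ := word_succ_apply (q := 0) (ψ := ψ) m 0
    rw [r1, r2, ih.2]
    have hC : 0 < Real.cos (ψ m / 2) :=
      Real.cos_pos_of_mem_Ioo ⟨by linarith [hψ0 m, Real.pi_pos], by linarith [hψπ m]⟩
    exact ⟨by simpa using mul_pos ih.1 hC, by ring⟩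

theorem sum_window {n : ℕ} {φ : ℕ → ℝ} (hper : ∀ k, φ (k + n) = φ k) (i : ℕ) :
    ∑ t ∈ Finset.range n, φ (i + t) = ∑ t ∈ Finset.range n, φ t := by
  induction i with
  | zero => simp
  | succ i ih =>
    rw [← ih]
    have h1 := Finset.sum_range_succ (fun t => φ (i + t)) n
    have h2 := Finset.sum_range_succ' (fun t => φ (i + t)) n
    rw [hper i] at h1
    simp only [add_zero] at h2
    have h3 : ∀ t, φ (i + 1 + t) = φ (i + (t + 1)) := fun t => by congr 1; ring
    simp only [h3]
    linarith

/-- Otherwise the sum over a period would be at most a single angle, which is less than π. In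
particular 2 ≤ n. -/
theorem exists_pos_window {n : ℕ} {φ : ℕ → ℝ} (hπ : ∀ k, φ k < Real.pi)
    (hper : ∀ k, φ (k + n) = φ k) (hsum : Real.pi < ∑ t ∈ Finset.range n, φ t) (i : ℕ) :
    ∃ t, t + 1 < n ∧ 0 < φ (i + t) := by
  by_contra! hcon
  rw [← sum_window hper i] at hsum
  rcases n with _ | n
  · simp only [Finset.range_zero, Finset.sum_empty] at hsum
    linarith [Real.pi_pos]
  · rw [Finset.sum_range_succ] at hsum
    have := Finset.sum_nonpos fun t (ht : t ∈ Finset.range n) =>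
      hcon t (by have := Finset.mem_range.1 ht; omega)
    linarith [hπ (i + n)]

theorem word_add_period {n : ℕ} {φ : ℕ → ℝ} (hper : ∀ k, φ (k + n) = φ k) (q : ℝ) (k : ℕ) :
    word q φ (k + n) = word q φ n * word q φ k := by
  rw [add_comm, word_add]
  congr 2
  funext t
  rw [add_comm, hper]

/-- Shifting the window by i conjugates the word by `word q φ i`. -/
theorem trace_word_window {n : ℕ} {φ : ℕ → ℝ} (hper : ∀ k, φ (k + n) = φ k) (hq : q ≠ 0) (i : ℕ) :
    (word q (fun t => φ (i + t)) n).trace = (word q φ n).trace := by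
  have h := word_add_period hper q i
  rw [word_add] at h
  have hu : IsUnit (word q φ i).det := by
    rw [det_word]; exact (pow_ne_zero i hq).isUnit
  have h2 : word q (fun t => φ (i + t)) n = (word q φ i)⁻¹ * (word q φ n * word q φ i) := by
    rw [← h, ← mul_assoc, Matrix.nonsing_inv_mul _ hu, one_mul]
  rw [h2, Matrix.trace_mul_comm, mul_assoc, Matrix.mul_nonsing_inv _ hu, mul_one]

/-- If a subword has a vanishing upper left entry, then the full word has negative trace. -/
theorem word_pos_of_nonneg {n : ℕ} (hq0 : 0 < q) (hq1 : q < 1) (hψ0 : ∀ j, 0 ≤ ψ j)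
    (hψπ : ∀ j, ψ j < Real.pi) (hex : ∃ j < n, 0 < ψ j) (ha : ∀ j ≤ n, 0 ≤ word q ψ j 0 0)
    (htr : 0 ≤ (word q ψ n).trace) (m : ℕ) (hm : m ≤ n) : 0 < word q ψ m 0 0 := by
  refine (ha m hm).lt_of_ne' fun h0 => ?_
  -- A zero entry persists: the next one is minus a product of nonnegative numbers. At length n the
  -- strict row inequality then makes the lower right entry, which is the trace, negative.
  have hall : ∀ t, m + t ≤ n → word q ψ (m + t) 0 0 = 0 := by
    intro t
    induction t with
    | zero => exact fun _ => h0
    | succ t ih =>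
      intro ht
      have e := ih (by omega)
      obtain ⟨hb, -⟩ := word_rows hq0 hq1 hψ0 hψπ (m + t) fun j hj => ha j (by omega)
      obtain ⟨r1, -⟩ := word_succ_apply (q := q) (ψ := ψ) (m + t) 0
      have hS : 0 ≤ Real.sin (ψ (m + t) / 2) :=
        Real.sin_nonneg_of_nonneg_of_le_pi (by linarith [hψ0 (m + t)])
          (by linarith [hψπ (m + t), Real.pi_pos])
      refine le_antisymm ?_ (ha _ ht)
      rw [← add_assoc, r1, e]
      linarith [mul_nonneg hb hS]
  have hn := hall (n - m) (by omega)
  rw [Nat.add_sub_cancel' hm] at hn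
  obtain ⟨hb, -, -, hlt⟩ := word_rows hq0 hq1 hψ0 hψπ n ha
  have hlt := hlt hex
  rw [Matrix.trace_fin_two, hn, zero_add] at htr
  rw [rowInner, hn, zero_mul, zero_add] at hlt
  linarith [mul_nonneg hb htr]

/-- There is a side length for which all subwords of length at most `n` have positive upper left
entry and the full word is a half-turn. -/
theorem exists_half_turn {n : ℕ} {φ : ℕ → ℝ} (h0 : ∀ k, 0 ≤ φ k) (hπ : ∀ k, φ k < Real.pi)
    (hper : ∀ k, φ (k + n) = φ k) (hsum : Real.pi < ∑ t ∈ Finset.range n, φ t) :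
    ∃ q : ℝ, 0 < q ∧ q < 1 ∧ (∀ i m, m ≤ n → 0 < word q (fun t => φ (i + t)) m 0 0) ∧
      (word q φ n).trace = 0 := by
  have hn : 0 < n := by
    obtain ⟨t, ht, -⟩ := exists_pos_window hπ hper hsum 0
    omega
  -- Pairs of a starting position modulo n and a length from 0 to n.
  set s : Finset (ℕ × ℕ) := Finset.range n ×ˢ Finset.range (n + 1) with hs
  have hsne : s.Nonempty := ⟨(0, 0), by simp [hs, hn]⟩
  let F : ℕ × ℕ → ℝ → ℝ := fun x q => word q (fun t => φ (x.1 + t)) x.2 0 0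
  let G : ℝ → ℝ := fun q => min (s.inf' hsne fun x => F x q) (word q φ n).trace
  have hF : ∀ x, Continuous (F x) := fun x => (continuous_word _ _).matrix_elem 0 0
  have hG : Continuous G :=
    (Continuous.finset_inf'_apply hsne fun x _ => hF x).min
      (continuous_word φ n).matrix_trace
  have hG_nonneg : ∀ q, 0 ≤ G q → (∀ i m, m ≤ n → 0 ≤ word q (fun t => φ (i + t)) m 0 0) ∧
      0 ≤ (word q φ n).trace := by
    intro q hq
    obtain ⟨h1, h2⟩ := le_min_iff.1 hq
    refine ⟨fun i m hm => ?_, h2⟩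
    have := (Finset.le_inf'_iff hsne _).1 h1 (i % n, m)
      (Finset.mem_product.2 ⟨Finset.mem_range.2 (Nat.mod_lt _ hn),
        Finset.mem_range.2 (by omega)⟩)
    have e : ∀ t, φ (i % n + t) = φ (i + t) := by
      intro t
      have hp : Function.Periodic φ n := hper
      rw [← hp.map_mod_nat, Nat.mod_add_mod, hp.map_mod_nat]
    simp only [F, e] at this
    exact this
  have hG0 : 0 < G 0 := by
    refine lt_min ((Finset.lt_inf'_iff hsne).2 fun x _ =>
      (word_zero_apply (fun j => h0 _) (fun j => hπ _) _).1) ?_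
    obtain ⟨k, rfl⟩ : ∃ k, n = k + 1 := ⟨n - 1, by omega⟩
    rw [Matrix.trace_fin_two, (word_succ_apply (q := 0) (ψ := φ) k 1).2, zero_mul, add_zero]
    exact (word_zero_apply h0 hπ _).1
  have hG1 : G 1 < 0 := by
    by_contra! hcon
    obtain ⟨h1, -⟩ := hG_nonneg 1 hcon
    have h1 : ∀ m ≤ n, 0 ≤ Real.cos ((∑ j ∈ Finset.range m, φ j) / 2) := by
      intro m hm
      have := h1 0 m hm
      simpa only [zero_add, (word_one_apply _ m).1] using this
    -- Each angle is below π, so the first partial sum above π would be below 2π, where the cosine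
    -- of its half is negative.
    have h2 : ∀ m ≤ n, ∑ j ∈ Finset.range m, φ j ≤ Real.pi := by
      intro m
      induction m with
      | zero => simpa using Real.pi_pos.le
      | succ m ih =>
        intro hm
        have ih := ih (by omega)
        have hc := h1 (m + 1) hm
        by_contra! hgt
        refine absurd hc (not_le.2 (Real.cos_neg_of_pi_div_two_lt_of_lt (by linarith) ?_))
        rw [Finset.sum_range_succ]
        linarith [hπ m, Real.pi_pos]
    exact absurd hsum (not_lt.2 (h2 n le_rfl))
  obtain ⟨q, ⟨hq0, hq1⟩, hGq⟩ : (0 : ℝ) ∈ G '' Set.Icc 0 1 :=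
    intermediate_value_Icc' zero_le_one hG.continuousOn ⟨hG1.le, hG0.le⟩
  have hq0 : 0 < q := hq0.lt_of_ne fun h => by rw [← h] at hGq; exact hG0.ne' hGq
  have hq1 : q < 1 := hq1.lt_of_ne fun h => by rw [h] at hGq; exact hG1.ne hGq
  obtain ⟨h1, h2⟩ := hG_nonneg q hGq.ge
  have hpos : ∀ i m, m ≤ n → 0 < word q (fun t => φ (i + t)) m 0 0 := by
    intro i m hm
    obtain ⟨t, ht, htpos⟩ := exists_pos_window hπ hper hsum i
    exact word_pos_of_nonneg hq0 hq1 (fun j => h0 _) (fun j => hπ _) ⟨t, by omega, htpos⟩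
      (fun j hj => h1 i j hj) (by rw [trace_word_window hper hq0.ne']; exact h2) m hm
  refine ⟨q, hq0, hq1, hpos, ?_⟩
  rcases min_choice (s.inf' hsne fun x => F x q) (word q φ n).trace with h | h
  · exfalso
    have : 0 < s.inf' hsne fun x => F x q := by
      refine (Finset.lt_inf'_iff hsne).2 fun x hx => hpos _ _ ?_
      have := Finset.mem_range.1 (Finset.mem_product.1 hx).2
      omega
    rw [← h] at this
    exact this.ne' hGq
  · rw [← h]; exact hGq

end HypPolygon

end

/-! ### Gram matrices: distances, orientation and directions from matrices. -/

noncomputable section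

namespace HypPolygon

/-- The Gram matrix `g * gᵀ`, as a vector of the Lorentzian space. -/
def gram (g : Matrix (Fin 2) (Fin 2) ℝ) : ℝ × ℝ × ℝ :=
  (g 0 0 ^ 2 + g 0 1 ^ 2, rowInner g, g 1 0 ^ 2 + g 1 1 ^ 2)

theorem sq_row_pos {g : Matrix (Fin 2) (Fin 2) ℝ} (hg : 0 < g.det) :
    0 < g 0 0 ^ 2 + g 0 1 ^ 2 ∧ 0 < g 1 0 ^ 2 + g 1 1 ^ 2 := by
  have h : 0 < (g 0 0 ^ 2 + g 0 1 ^ 2) * (g 1 0 ^ 2 + g 1 1 ^ 2) := by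
    have e : (g 0 0 ^ 2 + g 0 1 ^ 2) * (g 1 0 ^ 2 + g 1 1 ^ 2) = rowInner g ^ 2 + g.det ^ 2 := by
      rw [Matrix.det_fin_two, rowInner]; ring
    rw [e]
    positivity
  rcases mul_pos_iff.1 h with h | h
  · exact h
  · exact absurd h.1 (not_lt.2 (by positivity))

/-- The image of `I` under the Möbius transformation of a matrix with positive determinant. -/
def pt (g : Matrix (Fin 2) (Fin 2) ℝ) (hg : 0 < g.det) : ℍ :=
  ⟨⟨rowInner g / (g 1 0 ^ 2 + g 1 1 ^ 2), g.det / (g 1 0 ^ 2 + g 1 1 ^ 2)⟩,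
    div_pos hg (sq_row_pos hg).2⟩

theorem vec_pt {g : Matrix (Fin 2) (Fin 2) ℝ} (hg : 0 < g.det) :
    vec (pt g hg) = g.det⁻¹ • gram g := by
  have h1 : (pt g hg).re = rowInner g / (g 1 0 ^ 2 + g 1 1 ^ 2) := rfl
  have h2 : (pt g hg).im = g.det / (g 1 0 ^ 2 + g 1 1 ^ 2) := rfl
  have h3 := (sq_row_pos hg).2.ne'
  have h4 := hg.ne'
  have h5 : rowInner g ^ 2 + g.det ^ 2 =
      (g 0 0 ^ 2 + g 0 1 ^ 2) * (g 1 0 ^ 2 + g 1 1 ^ 2) := by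
    rw [Matrix.det_fin_two, rowInner]; ring
  refine Prod.ext ?_ (Prod.ext ?_ ?_)
  · simp only [vec, h1, h2, gram, Prod.smul_fst, smul_eq_mul]
    rw [div_pow, div_pow, ← add_div, h5]
    field_simp
  · simp only [vec, h1, h2, gram, Prod.smul_snd, Prod.smul_fst, smul_eq_mul]
    field_simp
  · simp only [vec, h2, gram, Prod.smul_snd, smul_eq_mul]
    field_simp

theorem gram_smul (c : ℝ) (g : Matrix (Fin 2) (Fin 2) ℝ) : gram (c • g) = c ^ 2 • gram g := by
  refine Prod.ext ?_ (Prod.ext ?_ ?_) <;>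
  · simp only [gram, rowInner, Matrix.smul_apply, Prod.smul_fst, Prod.smul_snd, smul_eq_mul]
    ring

theorem gram_mul_rotM (g : Matrix (Fin 2) (Fin 2) ℝ) (t : ℝ) : gram (g * rotM t) = gram g := by
  have h := Real.sin_sq_add_cos_sq (t / 2)
  refine Prod.ext ?_ (Prod.ext ?_ ?_)
  · simp only [gram, rotM, Matrix.mul_apply, Fin.sum_univ_two, Matrix.of_apply,
      Matrix.cons_val', Matrix.cons_val_zero, Matrix.cons_val_one, Matrix.cons_val_fin_one]
    linear_combination (g 0 0 ^ 2 + g 0 1 ^ 2) * h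
  · simp only [gram, rowInner, rotM, Matrix.mul_apply, Fin.sum_univ_two, Matrix.of_apply,
      Matrix.cons_val', Matrix.cons_val_zero, Matrix.cons_val_one, Matrix.cons_val_fin_one]
    linear_combination (g 0 0 * g 1 0 + g 0 1 * g 1 1) * h
  · simp only [gram, rotM, Matrix.mul_apply, Fin.sum_univ_two, Matrix.of_apply,
      Matrix.cons_val', Matrix.cons_val_zero, Matrix.cons_val_one, Matrix.cons_val_fin_one]
    linear_combination (g 1 0 ^ 2 + g 1 1 ^ 2) * h

theorem det_rotM (t : ℝ) : (rotM t).det = 1 := by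
  have := Real.sin_sq_add_cos_sq (t / 2)
  rw [rotM, Matrix.det_fin_two_of]
  linarith

theorem det_dilM (q : ℝ) : (dilM q).det = q := by simp [dilM, Matrix.det_fin_two_of]

theorem lorentz_gram_mul (g A : Matrix (Fin 2) (Fin 2) ℝ) :
    lorentz (gram g) (gram (g * A)) =
      g.det ^ 2 * ((A 0 0 ^ 2 + A 0 1 ^ 2 + A 1 0 ^ 2 + A 1 1 ^ 2) / 2) := by
  simp only [lorentz, gram, rowInner, Matrix.det_fin_two, Matrix.mul_apply, Fin.sum_univ_two]
  ring

theorem cosh_dist_pt {g A : Matrix (Fin 2) (Fin 2) ℝ} (hg : 0 < g.det) (hA : 0 < (g * A).det) :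
    Real.cosh (dist (pt g hg) (pt (g * A) hA)) =
      (A 0 0 ^ 2 + A 0 1 ^ 2 + A 1 0 ^ 2 + A 1 1 ^ 2) / (2 * A.det) := by
  have h1 := hg.ne'
  have h2 : A.det ≠ 0 := by
    intro h; rw [Matrix.det_mul, h, mul_zero] at hA; exact lt_irrefl _ hA
  rw [cosh_dist_eq_lorentz, vec_pt, vec_pt, lorentz_smul_right, lorentz_comm, lorentz_smul_right,
    lorentz_comm, lorentz_gram_mul, Matrix.det_mul]
  field_simp

/-- For q < 1 and positive `h.det`, a point reached by `W` from the end of a side is to the left of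
that side exactly when the rows of `W` have nonpositive inner product. -/
theorem det3_gram_dilM (h W : Matrix (Fin 2) (Fin 2) ℝ) (q : ℝ) :
    det3 (gram h) (gram (h * dilM q)) (gram (h * dilM q * W)) =
      -(h.det ^ 3 * q * (1 - q ^ 2) * rowInner W) := by
  simp only [det3, gram, rowInner, Matrix.det_fin_two, Matrix.mul_apply, Fin.sum_univ_two, dilM,
    Matrix.of_apply, Matrix.cons_val', Matrix.cons_val_zero, Matrix.cons_val_one,
    Matrix.cons_val_fin_one]
  ring

/-- The inner product of the two columns. -/
def colInner (A : Matrix (Fin 2) (Fin 2) ℝ) : ℝ := A 0 0 * A 0 1 + A 1 0 * A 1 1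

/-- For a point from which the end of the side is reached by `V`: the adjugate of `V` leads back,
and its row inner product is minus the column inner product of `V`. -/
theorem det3_gram_dilM_left {h V k : Matrix (Fin 2) (Fin 2) ℝ} {q : ℝ}
    (hk : h * dilM q = k * V) :
    V.det ^ 2 * det3 (gram h) (gram (h * dilM q)) (gram k) =
      h.det ^ 3 * q * (1 - q ^ 2) * colInner V := by
  have h1 := det3_gram_dilM h V.adjugate q
  have h2 : h * dilM q * V.adjugate = V.det • k := by
    rw [hk, mul_assoc, Matrix.mul_adjugate, mul_smul_comm, mul_one]
  have h3 : rowInner V.adjugate = -colInner V := by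
    rw [Matrix.adjugate_fin_two, rowInner, colInner]
    simp
    ring
  rw [h2, h3, gram_smul, det3_smul_right] at h1
  linarith

/-- The anti-automorphism of the matrix ring that fixes rotations and diagonal matrices. -/
def flipM (A : Matrix (Fin 2) (Fin 2) ℝ) : Matrix (Fin 2) (Fin 2) ℝ :=
  !![A 0 0, -A 1 0; -A 0 1, A 1 1]

theorem flipM_mul (A B : Matrix (Fin 2) (Fin 2) ℝ) : flipM (A * B) = flipM B * flipM A := by
  ext i j
  fin_cases i <;> fin_cases j <;>
  · simp [flipM, Matrix.mul_apply, Fin.sum_univ_two]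
    ring

theorem flipM_rotM (t : ℝ) : flipM (rotM t) = rotM t := by simp [flipM, rotM]

theorem flipM_dilM (q : ℝ) : flipM (dilM q) = dilM q := by simp [flipM, dilM]

variable {q : ℝ} {ψ : ℕ → ℝ}

/-- The flip reverses the order and fixes every letter; the dilation on each side restores the
alternation of rotation and dilation. -/
theorem dilM_mul_word_reverse (m : ℕ) (ψ : ℕ → ℝ) :
    dilM q * word q (fun t => ψ (m - 1 - t)) m = flipM (word q ψ m) * dilM q := by
  induction m generalizing ψ with
  | zero => simp [word, flipM, Matrix.one_fin_two, dilM]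
  | succ m ih =>
    have h1 : word q ψ (m + 1) = rotM (ψ 0) * dilM q * word q (fun t => ψ (1 + t)) m := by
      rw [add_comm, word_add]
      simp [word]
    have h2 : word q (fun t => ψ (m + 1 - 1 - t)) m =
        word q (fun t => ψ (1 + (m - 1 - t))) m :=
      word_congr m fun j hj => by
        congr 1
        omega
    rw [h1, flipM_mul, flipM_mul, flipM_rotM, flipM_dilM, word, h2, ← mul_assoc,
      ih fun t => ψ (1 + t)]
    simp [mul_assoc]

theorem word_reverse_apply (m : ℕ) (ψ : ℕ → ℝ) :
    word q (fun t => ψ (m - 1 - t)) m 0 0 = word q ψ m 0 0 ∧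
      word q (fun t => ψ (m - 1 - t)) m 0 1 = -(q * word q ψ m 1 0) ∧
      q * word q (fun t => ψ (m - 1 - t)) m 1 0 = -word q ψ m 0 1 ∧
      q * word q (fun t => ψ (m - 1 - t)) m 1 1 = q * word q ψ m 1 1 := by
  have h := dilM_mul_word_reverse (q := q) m ψ
  have e : ∀ i j, (dilM q * word q (fun t => ψ (m - 1 - t)) m) i j =
      (flipM (word q ψ m) * dilM q) i j := fun i j => by rw [h]
  have e00 := e 0 0
  have e01 := e 0 1
  have e10 := e 1 0
  have e11 := e 1 1
  simp only [Matrix.mul_apply, Fin.sum_univ_two, dilM, flipM, Matrix.of_apply,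
    Matrix.cons_val', Matrix.cons_val_zero, Matrix.cons_val_one, Matrix.cons_val_fin_one]
    at e00 e01 e10 e11
  refine ⟨?_, ?_, ?_, ?_⟩ <;> linarith

/-- Apply `word_rows` to the reversed word, whose initial subwords have the same upper left entries
as final subwords of the original. The first rotation of the word does not affect column inner
products, so m of the m + 1 letters suffice. -/
theorem colInner_word_nonneg (hq0 : 0 < q) (hq1 : q < 1) (hψ0 : ∀ j, 0 ≤ ψ j)
    (hψπ : ∀ j, ψ j < Real.pi) (m : ℕ)
    (ha : ∀ i j, i + j ≤ m → 0 ≤ word q (fun t => ψ (i + t)) j 0 0) :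
    0 ≤ colInner (word q ψ m) := by
  rcases m with _ | m
  · simp [word, colInner]
  set χ : ℕ → ℝ := fun t => ψ (m + 1 - 1 - t) with hχ
  obtain ⟨-, -, hip, -⟩ := word_rows (ψ := χ) hq0 hq1 (fun _ => hψ0 _) (fun _ => hψπ _) m (by
    intro j hj
    have h1 : word q χ j = word q (fun t => (fun s => ψ (m + 1 - j + s)) (j - 1 - t)) j :=
      word_congr j fun t ht => by
        change ψ _ = ψ _
        congr 1
        omega
    rw [h1]
    exact (ha _ _ (by omega)).trans_eq
      (word_reverse_apply j fun s => ψ (m + 1 - j + s)).1.symm)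
  obtain ⟨r1, r2⟩ := word_succ_apply (q := q) (ψ := χ) m 0
  obtain ⟨r3, r4⟩ := word_succ_apply (q := q) (ψ := χ) m 1
  obtain ⟨e1, e2, e3, e4⟩ := word_reverse_apply (q := q) (m + 1) ψ
  have hCS := Real.sin_sq_add_cos_sq (χ m / 2)
  simp only [← hχ] at e1 e2 e3 e4
  have key : q * colInner (word q ψ (m + 1)) = -(q ^ 2 * rowInner (word q χ m)) := by
    have f1 : q * colInner (word q ψ (m + 1)) =
        -(q ^ 2 * word q χ (m + 1) 0 0 * word q χ (m + 1) 1 0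
          + word q χ (m + 1) 0 1 * word q χ (m + 1) 1 1) := by
      have e4' := mul_left_cancel₀ hq0.ne' e4
      rw [colInner, ← e1, ← e4', e2, ← neg_eq_iff_eq_neg.2 e3]
      ring
    rw [f1, r1, r2, r3, r4, rowInner]
    linear_combination (-q ^ 2 * (word q χ m 0 0 * word q χ m 1 0
      + word q χ m 0 1 * word q χ m 1 1)) * hCS
  have : 0 ≤ q * colInner (word q ψ (m + 1)) := by
    rw [key]
    have := mul_nonneg (sq_nonneg q) (neg_nonneg.2 hip)
    linarith
  exact (mul_nonneg_iff_of_pos_left hq0).1 this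

theorem coe_pt {g : Matrix (Fin 2) (Fin 2) ℝ} (hg : 0 < g.det) :
    ((g 1 0 : ℂ) * Complex.I + g 1 1) ≠ 0 ∧
      (pt g hg : ℂ) = ((g 0 0 : ℂ) * Complex.I + g 0 1) / ((g 1 0 : ℂ) * Complex.I + g 1 1) := by
  have h3 := (sq_row_pos hg).2.ne'
  have hne : ((g 1 0 : ℂ) * Complex.I + g 1 1) ≠ 0 := by
    intro h
    have h1 := congrArg Complex.re h
    have h2 := congrArg Complex.im h
    simp at h1 h2
    apply h3
    rw [h1, h2]; ring
  refine ⟨hne, ?_⟩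
  rw [eq_div_iff hne]
  have hdet : g.det = g 0 0 * g 1 1 - g 0 1 * g 1 0 := Matrix.det_fin_two g
  apply Complex.ext
  · simp [pt, rowInner]
    field_simp
    rw [hdet]; ring
  · simp [pt, rowInner]
    field_simp
    rw [hdet]; ring

/-- A Möbius map multiplies all directions at `I` by one nonzero number u, so angles at `pt g hg`
can be computed at `I`. The quotient is the Cayley transform at `I` of the image of `I` under `A`.
-/
theorem direction_pt {g : Matrix (Fin 2) (Fin 2) ℝ} (hg : 0 < g.det) :
    ∃ u : ℂ, u ≠ 0 ∧ ∀ (A : Matrix (Fin 2) (Fin 2) ℝ) (hA : 0 < (g * A).det),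
      direction (pt g hg) (pt (g * A) hA) =
        u * ((((A 0 0 : ℂ) * Complex.I + A 0 1) - Complex.I * ((A 1 0 : ℂ) * Complex.I + A 1 1)) /
          (((A 0 0 : ℂ) * Complex.I + A 0 1) + Complex.I * ((A 1 0 : ℂ) * Complex.I + A 1 1))) := by
  obtain ⟨hne, hz⟩ := coe_pt hg
  have hne' : -((g 1 0 : ℂ) * Complex.I) + g 1 1 ≠ 0 := by
    intro h
    apply hne
    have := congrArg (starRingEnd ℂ) h
    simpa using this
  refine ⟨Complex.I * ((-((g 1 0 : ℂ) * Complex.I) + g 1 1) / ((g 1 0 : ℂ) * Complex.I + g 1 1)),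
    mul_ne_zero Complex.I_ne_zero (div_ne_zero hne' hne), fun A hA => ?_⟩
  obtain ⟨hne2, hw⟩ := coe_pt hA
  have hdet : (g.det : ℂ) = g 0 0 * g 1 1 - g 0 1 * g 1 0 := by
    rw [Matrix.det_fin_two]; push_cast; ring
  have hdet0 : (g.det : ℂ) ≠ 0 := by exact_mod_cast hg.ne'
  have hconj : (starRingEnd ℂ) (pt g hg : ℂ) =
      (-((g 0 0 : ℂ) * Complex.I) + g 0 1) / (-((g 1 0 : ℂ) * Complex.I) + g 1 1) := by
    rw [hz]; simp
  set α : ℂ := (A 0 0 : ℂ) * Complex.I + A 0 1 with hα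
  set β : ℂ := (A 1 0 : ℂ) * Complex.I + A 1 1 with hβ
  have hden : ((g * A) 1 0 : ℂ) * Complex.I + (g * A) 1 1 = g 1 0 * α + g 1 1 * β := by
    simp only [Matrix.mul_apply, Fin.sum_univ_two, hα, hβ]
    push_cast; ring
  have hnum : ((g * A) 0 0 : ℂ) * Complex.I + (g * A) 0 1 = g 0 0 * α + g 0 1 * β := by
    simp only [Matrix.mul_apply, Fin.sum_univ_two, hα, hβ]
    push_cast; ring
  rw [hden] at hne2
  have d1 : (pt (g * A) hA : ℂ) - pt g hg = g.det * (α - Complex.I * β) /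
      ((g 1 0 * α + g 1 1 * β) * ((g 1 0 : ℂ) * Complex.I + g 1 1)) := by
    rw [hw, hz, hden, hnum, div_sub_div _ _ hne2 hne, hdet]
    congr 1
    ring
  have d2 : (pt (g * A) hA : ℂ) - (starRingEnd ℂ) (pt g hg : ℂ) = g.det * (α + Complex.I * β) /
      ((g 1 0 * α + g 1 1 * β) * (-((g 1 0 : ℂ) * Complex.I) + g 1 1)) := by
    rw [hw, hconj, hden, hnum, div_sub_div _ _ hne2 hne', hdet]
    congr 1
    ring
  rw [direction, d1, d2]
  -- In this case both sides are 0, a quotient by zero being zero.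
  by_cases h0 : α + Complex.I * β = 0
  · simp [h0]
  · generalize (g 1 0 : ℂ) * α + g 1 1 * β = D at *
    generalize (g 1 0 : ℂ) * Complex.I + g 1 1 = E at *
    generalize -((g 1 0 : ℂ) * Complex.I) + g 1 1 = F at *
    field_simp

theorem angle_neg_mul_exp {r t : ℝ} (hr : 0 < r) (ht0 : 0 ≤ t) (htπ : t < Real.pi) :
    InnerProductGeometry.angle (-(r : ℂ)) (r * Complex.exp (t * Complex.I)) = Real.pi - t := by
  have h1 : (r : ℂ) = r • (1 : ℂ) := by simp
  have h2 : (r : ℂ) * Complex.exp (t * Complex.I) = r • Complex.exp (t * Complex.I) := by simp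
  rw [h2, h1, InnerProductGeometry.angle_neg_left, InnerProductGeometry.angle_smul_left_of_pos _ _ hr,
    InnerProductGeometry.angle_smul_right_of_pos _ _ hr, Complex.angle_one_left (Complex.exp_ne_zero _),
    Complex.arg_exp_mul_I, (toIocMod_eq_self Real.two_pi_pos).2, abs_of_nonneg ht0]
  constructor <;> linarith [Real.pi_pos]

end HypPolygon

end

/-! ### The polygonal walk and its central symmetry. -/

noncomputable section

namespace HypPolygon

theorem det_word_pos {q : ℝ} (hq0 : 0 < q) (φ : ℕ → ℝ) (k : ℕ) : 0 < (word q φ k).det := by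
  rw [det_word]; positivity

/-- The vertices of a polygonal line with exterior angles `φ`, all of whose sides have the length
determined by `q`. -/
def vertex {q : ℝ} (hq0 : 0 < q) (φ : ℕ → ℝ) (k : ℕ) : ℍ := pt (word q φ k) (det_word_pos hq0 φ k)

section

variable {q : ℝ} (hq0 : 0 < q) {φ : ℕ → ℝ}

theorem vec_vertex (k : ℕ) : vec (vertex hq0 φ k) = (q ^ k)⁻¹ • gram (word q φ k) := by
  rw [vertex, vec_pt, det_word]

theorem vertex_eq_pt {i k : ℕ} {A : Matrix (Fin 2) (Fin 2) ℝ} (h : word q φ i = word q φ k * A) :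
    vertex hq0 φ i = pt (word q φ k * A) (h ▸ det_word_pos hq0 φ i) := by
  simp only [vertex, h]

theorem cosh_dist_vertex_succ (k : ℕ) :
    Real.cosh (dist (vertex hq0 φ k) (vertex hq0 φ (k + 1))) = (1 + q ^ 2) / (2 * q) := by
  have h := Real.sin_sq_add_cos_sq (φ k / 2)
  rw [vertex_eq_pt hq0 (i := k + 1) (k := k) rfl, vertex, cosh_dist_pt, Matrix.det_mul, det_rotM, det_dilM, one_mul]
  congr 1
  simp only [rotM, dilM, Matrix.mul_apply, Fin.sum_univ_two, Matrix.of_apply,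
    Matrix.cons_val', Matrix.cons_val_zero, Matrix.cons_val_one, Matrix.cons_val_fin_one]
  linear_combination (1 + q ^ 2) * h

/-- Without turning, the translations multiply to a single one with parameter q^(m+1). -/
theorem cosh_dist_vertex_add (k m : ℕ) (h : ∀ t < m, φ (k + 1 + t) = 0) :
    Real.cosh (dist (vertex hq0 φ k) (vertex hq0 φ (k + (m + 1)))) =
      (1 + (q ^ (m + 1)) ^ 2) / (2 * q ^ (m + 1)) := by
  have hCS := Real.sin_sq_add_cos_sq (φ k / 2)
  have hw : word q φ (k + (m + 1)) =
      word q φ k * (rotM (φ k) * !![1, 0; 0, q ^ (m + 1)]) := by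
    rw [show k + (m + 1) = k + 1 + m by ring, word_add, word, word_of_eq_zero m h, mul_assoc]
    congr 1
    rw [mul_assoc]
    congr 1
    simp [dilM, pow_succ, mul_comm]
  rw [vertex_eq_pt hq0 hw, vertex, cosh_dist_pt, Matrix.det_mul, det_rotM, one_mul]
  congr 1
  · simp only [rotM, Matrix.mul_apply, Fin.sum_univ_two, Matrix.of_apply,
      Matrix.cons_val', Matrix.cons_val_zero, Matrix.cons_val_one, Matrix.cons_val_fin_one]
    linear_combination (1 + (q ^ (m + 1)) ^ 2) * hCS
  · simp [Matrix.det_fin_two_of]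

theorem det3_vertex_forward (k m : ℕ) :
    ∃ c : ℝ, (q < 1 → 0 < c) ∧ det3 (vec (vertex hq0 φ k)) (vec (vertex hq0 φ (k + 1)))
      (vec (vertex hq0 φ (k + 1 + m))) = -(c * rowInner (word q (fun t => φ (k + 1 + t)) m)) := by
  have h := det3_gram_dilM (word q φ k * rotM (φ k)) (word q (fun t => φ (k + 1 + t)) m) q
  have hw : word q φ k * rotM (φ k) * dilM q = word q φ (k + 1) := by rw [word, mul_assoc]
  rw [hw, ← word_add, gram_mul_rotM, Matrix.det_mul, det_rotM, mul_one, det_word] at h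
  refine ⟨(q ^ k)⁻¹ * (q ^ (k + 1))⁻¹ * (q ^ (k + 1 + m))⁻¹ * ((q ^ k) ^ 3 * q * (1 - q ^ 2)),
    fun hq1 => ?_, ?_⟩
  · have : 0 < 1 - q ^ 2 := sub_pos.2 (pow_lt_one₀ hq0.le hq1 two_ne_zero)
    positivity
  · rw [vec_vertex, vec_vertex, vec_vertex, det3_smul_right, det3_rotate, det3_smul_right,
      det3_rotate, det3_smul_right, det3_rotate, h]
    ring

theorem det3_vertex_backward (i k m : ℕ) (him : i + m = k + 1) :
    ∃ c : ℝ, (q < 1 → 0 < c) ∧ det3 (vec (vertex hq0 φ k)) (vec (vertex hq0 φ (k + 1)))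
      (vec (vertex hq0 φ i)) = c * colInner (word q (fun t => φ (i + t)) m) := by
  have hw : word q φ k * rotM (φ k) * dilM q = word q φ (k + 1) := by rw [word, mul_assoc]
  have h := det3_gram_dilM_left (h := word q φ k * rotM (φ k)) (k := word q φ i)
    (V := word q (fun t => φ (i + t)) m) (q := q) (by rw [hw, ← word_add, him])
  rw [hw, gram_mul_rotM, Matrix.det_mul, det_rotM, mul_one, det_word, det_word] at h
  refine ⟨(q ^ k)⁻¹ * (q ^ (k + 1))⁻¹ * (q ^ i)⁻¹ * ((q ^ k) ^ 3 * q * (1 - q ^ 2))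
    * ((q ^ m) ^ 2)⁻¹, fun hq1 => ?_, ?_⟩
  · have : 0 < 1 - q ^ 2 := sub_pos.2 (pow_lt_one₀ hq0.le hq1 two_ne_zero)
    positivity
  · rw [vec_vertex, vec_vertex, vec_vertex, det3_smul_right, det3_rotate, det3_smul_right,
      det3_rotate, det3_smul_right, det3_rotate, mul_assoc _ (((q ^ m) ^ 2)⁻¹) _,
      mul_comm (((q ^ m) ^ 2)⁻¹), mul_assoc _ ((q ^ k) ^ 3 * q * (1 - q ^ 2)), ← mul_assoc ((q ^ k) ^ 3 * q * (1 - q ^ 2)), ← h]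
    have : (q ^ m) ^ 2 ≠ 0 := by positivity
    field_simp

/-- In the frame of the middle vertex the directions to its neighbours are -r and r exp(iφ), with r
= (1 - q)/(1 + q). -/
theorem hypAngle_vertex (hq1 : q < 1) (hφ0 : ∀ k, 0 ≤ φ k) (hφπ : ∀ k, φ k < Real.pi) (k : ℕ) :
    hypAngle (vertex hq0 φ k) (vertex hq0 φ (k + 1)) (vertex hq0 φ (k + 2)) =
      Real.pi - φ (k + 1) := by
  have hg := det_word_pos hq0 φ (k + 1)
  obtain ⟨u, hu, hdir⟩ := direction_pt hg
  -- Up to the scalar q this diagonal matrix inverts `dilM q`, so it steps back along the side.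
  have hback : word q φ (k + 1) * !![q, 0; 0, 1] = q • (word q φ k * rotM (φ k)) := by
    rw [word, mul_assoc, mul_assoc]
    have : dilM q * !![q, 0; 0, 1] = q • (1 : Matrix (Fin 2) (Fin 2) ℝ) := by
      simp [dilM, Matrix.one_fin_two]
    rw [this]
    simp
  have hk : 0 < (word q φ (k + 1) * !![q, 0; 0, 1]).det := by
    rw [Matrix.det_mul, Matrix.det_fin_two_of]
    simpa using mul_pos hg hq0
  have e1 : vertex hq0 φ k = pt (word q φ (k + 1) * !![q, 0; 0, 1]) hk := by
    apply vec_injective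
    rw [vec_vertex, vec_pt, hback, gram_smul, gram_mul_rotM, Matrix.det_smul, Fintype.card_fin,
      smul_smul, Matrix.det_mul, det_rotM, det_word]
    congr 1
    field_simp
  have d1 := hdir _ hk
  have hw : word q φ (k + 2) = word q φ (k + 1) * (rotM (φ (k + 1)) * dilM q) := rfl
  have d2 := hdir (rotM (φ (k + 1)) * dilM q) (hw ▸ det_word_pos hq0 φ (k + 2))
  rw [← e1] at d1
  rw [← vertex_eq_pt hq0 hw] at d2
  change direction (vertex hq0 φ (k + 1)) (vertex hq0 φ k) = _ at d1
  change direction (vertex hq0 φ (k + 1)) (vertex hq0 φ (k + 2)) = _ at d2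
  rw [hypAngle, d1, d2, Complex.angle_mul_left hu]
  have hr : 0 < (1 - q) / (1 + q) := div_pos (by linarith) (by linarith)
  rw [← angle_neg_mul_exp hr (hφ0 (k + 1)) (hφπ (k + 1))]
  have hq1' : (1 : ℂ) + q ≠ 0 := by
    have : (1 : ℝ) + q ≠ 0 := by positivity
    exact_mod_cast this
  have hI : Complex.I ^ 2 = -1 := Complex.I_sq
  congr 1
  · simp only [Matrix.of_apply, Matrix.cons_val', Matrix.cons_val_zero, Matrix.cons_val_one,
      Matrix.cons_val_fin_one]
    push_cast
    have h1 : ((q : ℂ) * Complex.I + 0 + Complex.I * (0 * Complex.I + 1)) =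
        Complex.I * (1 + q) := by ring
    have h2 : ((q : ℂ) * Complex.I + 0 - Complex.I * (0 * Complex.I + 1)) =
        Complex.I * (-(1 - q)) := by ring
    rw [h1, h2, mul_div_mul_left _ _ Complex.I_ne_zero, neg_div]
  · set C := Real.cos (φ (k + 1) / 2) with hC
    set S := Real.sin (φ (k + 1) / 2) with hS
    have hCS : (S : ℂ) ^ 2 + (C : ℂ) ^ 2 = 1 := by
      exact_mod_cast Real.sin_sq_add_cos_sq (φ (k + 1) / 2)
    have hexp : Complex.exp ((φ (k + 1) : ℂ) * Complex.I) =
        ((C : ℂ) + S * Complex.I) ^ 2 := by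
      have h1 : (φ (k + 1) : ℂ) * Complex.I =
          ((φ (k + 1) / 2 : ℝ) : ℂ) * Complex.I + ((φ (k + 1) / 2 : ℝ) : ℂ) * Complex.I := by
        push_cast; ring
      rw [h1, Complex.exp_add, Complex.exp_mul_I, hC, hS, Complex.ofReal_cos, Complex.ofReal_sin]
      ring
    have hmul : ((C : ℂ) + S * Complex.I) * (C - S * Complex.I) = 1 := by
      linear_combination hCS - (S : ℂ) ^ 2 * hI
    have hne : (C : ℂ) - S * Complex.I ≠ 0 := right_ne_zero_of_mul_eq_one hmul
    rw [hexp]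
    simp only [rotM, dilM, Matrix.mul_apply, Fin.sum_univ_two, Matrix.of_apply,
      Matrix.cons_val', Matrix.cons_val_zero, Matrix.cons_val_one, Matrix.cons_val_fin_one,
      ← hC, ← hS]
    push_cast
    have h1 : ((C : ℂ) * 1 + S * 0) * Complex.I + (C * 0 + S * q) +
        Complex.I * ((-(S : ℂ) * 1 + C * 0) * Complex.I + (-(S : ℂ) * 0 + C * q)) =
          (1 + q) * Complex.I * (C - S * Complex.I) := by
      linear_combination ((q : ℂ) * S) * hI
    have h2 : ((C : ℂ) * 1 + S * 0) * Complex.I + (C * 0 + S * q) -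
        Complex.I * ((-(S : ℂ) * 1 + C * 0) * Complex.I + (-(S : ℂ) * 0 + C * q)) =
          (1 - q) * Complex.I * (C + S * Complex.I) := by
      linear_combination ((q : ℂ) * S) * hI
    rw [h1, h2, div_eq_iff (mul_ne_zero (mul_ne_zero hq1' Complex.I_ne_zero) hne)]
    have h3 : ((1 : ℂ) - q) / (1 + q) * (C + S * Complex.I) ^ 2 *
        ((1 + q) * Complex.I * (C - S * Complex.I)) = ((1 : ℂ) - q) / (1 + q) * (1 + q) *
          Complex.I * (C + S * Complex.I) * ((C + S * Complex.I) * (C - S * Complex.I)) := by ring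
    rw [h3, hmul, div_mul_cancel₀ _ hq1', mul_one]

theorem vertex_periodic {n : ℕ} (hper : ∀ k, φ (k + n) = φ k) (htr : (word q φ n).trace = 0)
    (k : ℕ) : vertex hq0 φ (k + 2 * n) = vertex hq0 φ k := by
  -- Cayley–Hamilton with trace 0 and determinant q^n.
  have hsq : word q φ n * word q φ n = (-q ^ n) • (1 : Matrix (Fin 2) (Fin 2) ℝ) := by
    have hd := det_word q φ n
    rw [Matrix.det_fin_two] at hd
    rw [Matrix.trace_fin_two] at htr
    ext i j
    fin_cases i <;> fin_cases j <;> simp [Matrix.mul_apply, Fin.sum_univ_two]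
    · linear_combination (word q φ n 0 0) * htr - hd
    · linear_combination (word q φ n 0 1) * htr
    · linear_combination (word q φ n 1 0) * htr
    · linear_combination (word q φ n 1 1) * htr - hd
  have hw : word q φ (k + 2 * n) = (-q ^ n) • word q φ k := by
    rw [two_mul, ← add_assoc, word_add_period hper, word_add_period hper, ← mul_assoc, hsq,
      smul_mul_assoc, one_mul]
  apply vec_injective
  rw [vec_vertex, vec_vertex, hw, gram_smul, smul_smul]
  congr 1
  rw [pow_add, two_mul, pow_add]
  field_simp

/-- The center of the half-turn `N`, up to a positive scalar. -/
def halfTurnCenter (N : Matrix (Fin 2) (Fin 2) ℝ) : ℝ × ℝ × ℝ :=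
  N 1 0 • (-N 0 1, N 0 0, N 1 0)

/-- A point and its image under a half-turn add up to a multiple of the fixed vector. -/
theorem vertex_antipodal {n : ℕ} (hper : ∀ k, φ (k + n) = φ k) (htr : (word q φ n).trace = 0)
    (k : ℕ) : ∃ μ : ℝ, 0 < μ ∧ vec (vertex hq0 φ k) + vec (vertex hq0 φ (k + n)) =
      μ • halfTurnCenter (word q φ n) := by
  have hδ := det_word q φ n
  have hδ0 : 0 < q ^ n := by positivity
  have he := det_word q φ k
  have he0 : 0 < q ^ k := by positivity
  have hupos := (sq_row_pos (det_word_pos hq0 φ k)).1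
  have hgr : gram (word q φ k) = (word q φ k 0 0 ^ 2 + word q φ k 0 1 ^ 2,
      rowInner (word q φ k), word q φ k 1 0 ^ 2 + word q φ k 1 1 ^ 2) := rfl
  rw [vec_vertex, vec_vertex, word_add_period hper, halfTurnCenter, pow_add]
  rw [Matrix.det_fin_two] at hδ he
  rw [Matrix.trace_fin_two] at htr
  generalize word q φ n = N at *
  generalize word q φ k = A at *
  generalize q ^ n = δ at *
  generalize q ^ k = e at *
  have hN : N 1 1 = -N 0 0 := by linarith
  rw [hN] at hδ
  set u := A 0 0 ^ 2 + A 0 1 ^ 2 with hu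
  set v := rowInner A with hv
  set w := A 1 0 ^ 2 + A 1 1 ^ 2 with hw
  have huvw : u * w = v ^ 2 + e ^ 2 := by
    rw [hu, hv, hw, rowInner, ← he]; ring
  have hc : N 1 0 ≠ 0 := by
    intro h
    rw [h] at hδ
    nlinarith [sq_nonneg (N 0 0)]
  -- Multiplying by u > 0 and completing the square exhibits a positive sum, by u w = v² + e² and
  -- det N = δ > 0.
  have hlam : 0 < (N 1 0 * u - 2 * N 0 0 * v - N 0 1 * w) * N 1 0 := by
    have h1 : u * ((N 1 0 * u - 2 * N 0 0 * v - N 0 1 * w) * N 1 0) =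
        (N 1 0 * u - N 0 0 * v) ^ 2 + δ * v ^ 2 + (N 0 0 ^ 2 + δ) * e ^ 2 := by
      linear_combination (-N 0 1 * N 1 0) * huvw + (v ^ 2 + e ^ 2) * hδ
    have h2 : 0 < u * ((N 1 0 * u - 2 * N 0 0 * v - N 0 1 * w) * N 1 0) := by
      rw [h1]; positivity
    exact (mul_pos_iff_of_pos_left hupos).1 h2
  have hgN : gram (N * A) =
      (N 0 0 ^ 2 * u + 2 * N 0 0 * N 0 1 * v + N 0 1 ^ 2 * w,
        N 0 0 * N 1 0 * u + (N 0 1 * N 1 0 - N 0 0 ^ 2) * v - N 0 0 * N 0 1 * w,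
        N 1 0 ^ 2 * u - 2 * N 0 0 * N 1 0 * v + N 0 0 ^ 2 * w) := by
    refine Prod.ext ?_ (Prod.ext ?_ ?_) <;>
    · simp only [gram, rowInner, Matrix.mul_apply, Fin.sum_univ_two, hN, hu, hv, hw]
      ring
  -- The factor is read off from the last coordinate, which is (N 1 0)² for the center.
  refine ⟨(N 1 0 * u - 2 * N 0 0 * v - N 0 1 * w) * N 1 0 / (N 1 0 ^ 2 * δ * e), ?_, ?_⟩
  · have : 0 < N 1 0 ^ 2 := by positivity
    positivity
  · rw [hgN, hgr]
    have hδ' : δ = -N 0 0 ^ 2 - N 0 1 * N 1 0 := by linarith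
    refine Prod.ext ?_ (Prod.ext ?_ ?_)
    · simp only [Prod.fst_add, Prod.smul_fst, smul_eq_mul]
      field_simp
      rw [hδ']; ring
    · simp only [Prod.fst_add, Prod.snd_add, Prod.smul_fst, Prod.smul_snd, smul_eq_mul]
      field_simp
      rw [hδ']; ring
    · simp only [Prod.snd_add, Prod.smul_snd, smul_eq_mul]
      field_simp
      rw [hδ']; ring

theorem exists_isCentralChain {n : ℕ} (hq1 : q < 1) (hφ0 : ∀ k, 0 ≤ φ k)
    (hφπ : ∀ k, φ k < Real.pi) (hper : ∀ k, φ (k + n) = φ k)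
    (hsum : Real.pi < ∑ t ∈ Finset.range n, φ t)
    (ha : ∀ i m, m ≤ n → 0 < word q (fun t => φ (i + t)) m 0 0)
    (htr : (word q φ n).trace = 0) :
    ∃ o μ, IsCentralChain n (vertex hq0 φ) o μ := by
  choose μ hμ hanti using vertex_antipodal hq0 hper htr
  have hn : 2 ≤ n := by
    obtain ⟨t, ht, -⟩ := exists_pos_window hφπ hper hsum 0
    omega
  have hvper := vertex_periodic hq0 hper htr
  have forward : ∀ k m, m ≤ n → 0 ≤ det3 (vec (vertex hq0 φ k)) (vec (vertex hq0 φ (k + 1)))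
      (vec (vertex hq0 φ (k + 1 + m))) ∧ ((∃ t < m, 0 < φ (k + 1 + t)) →
        0 < det3 (vec (vertex hq0 φ k)) (vec (vertex hq0 φ (k + 1)))
          (vec (vertex hq0 φ (k + 1 + m)))) := by
    intro k m hm
    obtain ⟨c, hc, he⟩ := det3_vertex_forward hq0 (φ := φ) k m
    obtain ⟨-, -, h1, h2⟩ := word_rows (ψ := fun t => φ (k + 1 + t)) hq0 hq1 (fun _ => hφ0 _)
      (fun _ => hφπ _) m fun j hj => (ha _ j (hj.trans hm)).le
    rw [he, ← mul_neg]
    exact ⟨mul_nonneg (hc hq1).le (neg_nonneg.2 h1),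
      fun h => mul_pos (hc hq1) (neg_pos.2 (h2 h))⟩
  have hleft : ∀ k j, 0 ≤ det3 (vec (vertex hq0 φ k)) (vec (vertex hq0 φ (k + 1)))
      (vec (vertex hq0 φ j)) := by
    intro k j
    have hp : Function.Periodic (vertex hq0 φ) (2 * n) := hvper
    -- By periodicity the vertex is r < 2n steps past the end of the side; for r > n it is seen as
    -- lying 2n - r < n steps before the end of the side's next copy.
    obtain ⟨r, hr, hrj⟩ : ∃ r < 2 * n, vertex hq0 φ (k + 1 + r) = vertex hq0 φ j := by
      refine ⟨(j + (k + 1) * (2 * n) - (k + 1)) % (2 * n), Nat.mod_lt _ (by omega), ?_⟩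
      have h1 : k + 1 + (j + (k + 1) * (2 * n) - (k + 1)) = j + (k + 1) * (2 * n) := by
        have : k + 1 ≤ (k + 1) * (2 * n) := Nat.le_mul_of_pos_right _ (by omega)
        omega
      rw [← hp.map_mod_nat, Nat.add_mod_mod, hp.map_mod_nat, h1]
      exact hp.nat_mul (k + 1) j
    rw [← hrj]
    by_cases hrn : r ≤ n
    · exact (forward k r hrn).1
    · obtain ⟨c, hc, he⟩ := det3_vertex_backward hq0 (φ := φ) (k + 1 + r) (k + 2 * n) (2 * n - r)
        (by omega)
      rw [add_right_comm, hvper, hvper] at he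
      rw [he]
      refine mul_nonneg (hc hq1).le (colInner_word_nonneg hq0 hq1 (fun _ => hφ0 _)
        (fun _ => hφπ _) _ fun i j hij => ?_)
      simp only [← add_assoc]
      exact (ha _ j (by omega)).le
  refine ⟨halfTurnCenter (word q φ n), μ, hn, hvper, hμ, hanti, hleft, ?_, ?_⟩
  · intro k
    -- The center is a positive multiple of P_k + P_{k+n}, so strict leftness of P_{k+n} is enough.
    obtain ⟨t, ht, htpos⟩ := exists_pos_window hφπ hper hsum (k + 1)
    have h1 := (forward k (n - 1) (by omega)).2 ⟨t, by omega, htpos⟩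
    rw [show k + 1 + (n - 1) = k + n by omega] at h1
    have h2 : det3 (vec (vertex hq0 φ k)) (vec (vertex hq0 φ (k + 1)))
        (vec (vertex hq0 φ k) + vec (vertex hq0 φ (k + n))) =
          det3 (vec (vertex hq0 φ k)) (vec (vertex hq0 φ (k + 1)))
            (vec (vertex hq0 φ (k + n))) := by
      rw [det3_add_right, det3_self_outer, zero_add]
    rw [← h2, hanti, det3_smul_right] at h1
    exact (mul_pos_iff_of_pos_left (hμ k)).1 h1
  · intro k m hm2 hmn hmem
    obtain ⟨m, rfl⟩ : ∃ l, m = l + 1 := ⟨m - 1, by omega⟩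
    -- A turn in between would put the vertex strictly to the left of the side. Without turns it is
    -- several side lengths away from `P k`, too far to be on the side.
    have hz : ∀ t < m, φ (k + 1 + t) = 0 := by
      by_contra! hcon
      obtain ⟨t, ht, hne⟩ := hcon
      have h1 := (forward k m (by omega)).2 ⟨t, ht, (hφ0 _).lt_of_ne' hne⟩
      obtain ⟨α, β, -, -, heq⟩ := exists_vec_eq_of_mem_geodSegment hmem
      rw [show k + 1 + m = k + (m + 1) by ring, heq, det3_add_right, det3_smul_right,
        det3_smul_right, det3_self_outer, det3_self_right] at h1
      simp at h1
    have hd : dist (vertex hq0 φ k) (vertex hq0 φ (k + (m + 1))) ≤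
        dist (vertex hq0 φ k) (vertex hq0 φ (k + 1)) := by
      have h1 : dist (vertex hq0 φ k) (vertex hq0 φ (k + (m + 1))) +
        dist (vertex hq0 φ (k + (m + 1))) (vertex hq0 φ (k + 1)) =
          dist (vertex hq0 φ k) (vertex hq0 φ (k + 1)) := hmem
      linarith [dist_nonneg (x := vertex hq0 φ (k + (m + 1))) (y := vertex hq0 φ (k + 1))]
    have hcosh := Real.cosh_le_cosh.2 (by rwa [abs_of_nonneg dist_nonneg,
      abs_of_nonneg dist_nonneg] : |dist (vertex hq0 φ k) (vertex hq0 φ (k + (m + 1)))| ≤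
        |dist (vertex hq0 φ k) (vertex hq0 φ (k + 1))|)
    rw [cosh_dist_vertex_succ, cosh_dist_vertex_add hq0 k m hz] at hcosh
    have hx0 : 0 < q ^ (m + 1) := by positivity
    have hxq : q ^ (m + 1) < q := by
      rw [pow_succ]
      exact mul_lt_of_lt_one_left hq0 (pow_lt_one₀ hq0.le hq1 (by omega))
    generalize q ^ (m + 1) = x at *
    rw [div_le_div_iff₀ (by positivity) (by positivity)] at hcosh
    -- This product equals q(1 + x²) - x(1 + q²), so it contradicts the comparison of hyperbolic
    -- cosines.
    have h3 : 0 < (q - x) * (1 - q * x) := mul_pos (by linarith) (by nlinarith)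
    linarith

end

theorem finRotate_symm_apply_periodic {n : ℕ} {P : ℕ → ℍ} {o : ℝ × ℝ × ℝ} {μ : ℕ → ℝ}
    (h : IsCentralChain n P o μ) (i : Fin (2 * n)) :
    P ((finRotate (2 * n)).symm i) = P (i + (2 * n - 1)) := by
  have h1 : (i : ℕ) = ((finRotate (2 * n)).symm i + 1) % (2 * n) := by
    rw [← IsCentralChain.finRotate_val, Equiv.apply_symm_apply]
  have h2 := h.two_le
  rw [← h.mod_eq (i + (2 * n - 1)), h1, Nat.mod_add_mod, add_assoc,
    show 1 + (2 * n - 1) = 2 * n by omega, h.mod_eq, h.periodic]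

end HypPolygon

end

/-! ### Assembly of the theorem. -/

theorem mainTheorem7 (n : ℕ) (θ : Fin n → ℝ)
    (hpos : ∀ i, 0 < θ i) (hle : ∀ i, θ i ≤ Real.pi)
    (hsum : ∑ i, θ i < ((n : ℝ) - 1) * Real.pi) :
    ∃ P : Fin (2 * n) → UpperHalfPlane,
      HypPolygon.IsConvexPolygon P ∧ HypPolygon.IsEquilateral P ∧
        ∀ i : Fin (2 * n), HypPolygon.vertexAngle P i = θ i.modNat := by
  have hn : 0 < n := by
    rcases Nat.eq_zero_or_pos n with rfl | h
    · have := Real.pi_pos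
      simp at hsum
      linarith
    · exact h
  let φ : ℕ → ℝ := fun k => Real.pi - θ ⟨k % n, Nat.mod_lt _ hn⟩
  have hφ0 : ∀ k, 0 ≤ φ k := fun k => sub_nonneg.2 (hle _)
  have hφπ : ∀ k, φ k < Real.pi := fun k => sub_lt_self _ (hpos _)
  have hper : ∀ k, φ (k + n) = φ k := fun k => by simp only [φ, Nat.add_mod_right]
  have hper2 : ∀ k, φ (k + 2 * n) = φ k := fun k => by
    rw [two_mul, ← add_assoc, hper, hper]
  have hφsum : Real.pi < ∑ t ∈ Finset.range n, φ t := by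
    have h1 : ∑ t ∈ Finset.range n, φ t = ∑ i : Fin n, (Real.pi - θ i) := by
      rw [Finset.sum_range]
      exact Finset.sum_congr rfl fun i _ => by simp only [φ, Nat.mod_eq_of_lt i.2]
    rw [h1, Finset.sum_sub_distrib, Finset.sum_const, Finset.card_univ, Fintype.card_fin,
      nsmul_eq_mul]
    linarith
  obtain ⟨q, hq0, hq1, ha, htr⟩ := HypPolygon.exists_half_turn hφ0 hφπ hper hφsum
  obtain ⟨o, μ, hchain⟩ := HypPolygon.exists_isCentralChain hq0 hq1 hφ0 hφπ hper hφsum ha htr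
  refine ⟨fun i => HypPolygon.vertex hq0 φ i, hchain.isConvexPolygon,
    ⟨dist (HypPolygon.vertex hq0 φ 0) (HypPolygon.vertex hq0 φ 1),
      dist_pos.2 (hchain.ne_succ 0), fun i => ?_⟩, fun i => ?_⟩
  · simp only [hchain.apply_finRotate]
    have h1 := HypPolygon.cosh_dist_vertex_succ hq0 (φ := φ) i
    rw [← HypPolygon.cosh_dist_vertex_succ hq0 (φ := φ) 0] at h1
    have h2 := le_antisymm (Real.cosh_le_cosh.1 h1.le) (Real.cosh_le_cosh.1 h1.ge)
    rwa [abs_of_nonneg dist_nonneg, abs_of_nonneg dist_nonneg] at h2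
  · have h1 := HypPolygon.hypAngle_vertex hq0 hq1 hφ0 hφπ (i + (2 * n - 1))
    rw [show (i : ℕ) + (2 * n - 1) + 1 = i + 2 * n by omega,
      show (i : ℕ) + (2 * n - 1) + 2 = i + 1 + 2 * n by omega, hchain.periodic, hchain.periodic,
      hper2] at h1
    simp only [HypPolygon.vertexAngle, HypPolygon.finRotate_symm_apply_periodic hchain,
      hchain.apply_finRotate, h1]
    simp only [φ, sub_sub_cancel]
    rfl
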